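/- There are absolute constants $C>0$ and $K\in\mathbb N$ such that the following holds. Let $I,J\subseteq\mathbb R$ be convex sets (for example $I=J=\mathbb R$), let $f$ be a real function that is strictly convex or strictly concave on $I$, and let $g$ be a real function that is strictly convex or strictly concave on $J$ (one may be convex and the other concave). Let $A\subseteq I$ and $B\subseteq J$ be finite sets, and put $L=\log(2+|A||B|)$. Write $X\pm Y=\{x\pm y: x\in X,\ y\in Y\}$ for finite $X,Y\subseteq\mathbb R$. Then $$(|A||B|)^{49}\le C\,L^{K}\,|A+B|^{38}\,|f(A)+g(B)|^{38},$$ and, for each of the four independent choices of the two signs $\pm$, $$|A|^{39}|B|^{39}\le C\,L^{K}\,|A\pm B|^{20}\,|f(A)\pm g(B)|^{20}\,|A-A|^{5}\,|B-B|^{5}\,|f(A)-f(A)|^{5}\,|g(B)-g(B)|^{5}.$$ -/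

import Mathlib

open scoped Pointwise

/-! Write r for representation counts (`rep`). A strictly convex function has a given chord vector
at only one place, so two points determine a translate of its graph. A cell decomposition then gives
a Szemerédi–Trotter type bound: on a monotone piece A, the sum of r_{C+Y}(x) r_{C'+Y'}(f(x)) over x
in A is O((|C||Y||C'||Y'|)^{2/3}); this is `Curved`.

Hence A and f(A) cannot both be additively structured. By `Curved.exists_halves` there are X, Y ⊆ A,
each at least half of A, such that X and f(Y) satisfy `SumBound` with constants l, m and lm ≪ |A|
log|A|. In turn `SumBound` controls third moments: ∑ r_{X+Z}^3 ≪ l^3 |Z|^2 log (`sum_rep_cube_le`).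

Now let A, B be any sets satisfying `SumBound` with constants l, m. The core estimate
`card_pairsIn_pow_le` bounds the number N of pairs a, a' of popular elements of A with a - a' in D.
Translation by at least half of the b in B sends such a pair to two popular sums with the same
difference. Cauchy–Schwarz bounds N by the number of pairs of popular sums with difference in D and
a mixed energy of A and B. Popularity lets one sum be rewritten as a + b, which turns the pair count
into solutions of a - δ = s' - b. Hölder and the third moments bound both quantities.

Taking D = A - A gives `differenceSet_bound`; taking D to be a level set of r_{A-A} on the popular
part bounds its additive energy and gives `sumset_bound`. These are applied to the halves of A and B
and to the images of the other halves. In the product, l and m occur to equal powers and are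
eliminated by lm ≪ |A| log|A| (`combine_halves`). -/

/-! ### Representation counts and `SumBound`. -/

/-- The number of representations `x = c + y` with `c ∈ C`, `y ∈ Y`. -/
noncomputable def rep (C Y : Finset ℝ) (x : ℝ) : ℕ :=
  ((C ×ˢ Y).filter fun p => p.1 + p.2 = x).card

/-- The quantity `(|C| |Y|) ^ (2 / 3)`. -/
noncomputable def gridSize (C Y : Finset ℝ) : ℝ :=
  ((C.card : ℝ) * (Y.card : ℝ)) ^ (2 / 3 : ℝ)

/-- `X` receives at most `l (|C| |Y|) ^ (2 / 3)` representations as sums from `C + Y`,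
for all finite `C` and `Y`. -/
def SumBound (X : Finset ℝ) (l : ℝ) : Prop :=
  ∀ C Y : Finset ℝ, ∑ x ∈ X, (rep C Y x : ℝ) ≤ l * gridSize C Y

theorem gridSize_nonneg (C Y : Finset ℝ) : 0 ≤ gridSize C Y := by
  unfold gridSize; positivity

theorem gridSize_cube (C Y : Finset ℝ) :
    gridSize C Y ^ 3 = ((C.card : ℝ) * (Y.card : ℝ)) ^ 2 := by
  unfold gridSize
  rw [← Real.rpow_natCast, ← Real.rpow_mul (by positivity), ← Real.rpow_natCast]
  norm_num

theorem rep_eq_card (C Y : Finset ℝ) (x : ℝ) :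
    rep C Y x = (C.filter fun c => x - c ∈ Y).card := by
  unfold rep
  refine Finset.card_bij' (fun p _ => p.1) (fun c _ => (c, x - c)) ?_ ?_ ?_ ?_
  · rintro ⟨c, y⟩ h
    simp only [Finset.mem_filter, Finset.mem_product] at h ⊢
    obtain ⟨⟨hc, hy⟩, rfl⟩ := h
    simp [hc, hy]
  · intro c h
    simp only [Finset.mem_filter, Finset.mem_product] at h ⊢
    exact ⟨h, by ring⟩
  · rintro ⟨c, y⟩ h
    simp only [Finset.mem_filter, Finset.mem_product] at h
    obtain ⟨-, rfl⟩ := h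
    simp
  · intro c h
    rfl

theorem rep_comm (C Y : Finset ℝ) (x : ℝ) : rep C Y x = rep Y C x := by
  unfold rep
  refine Finset.card_bij' (fun p _ => (p.2, p.1)) (fun p _ => (p.2, p.1)) ?_ ?_ ?_ ?_ <;>
    simp +contextual [add_comm]

theorem rep_le_card_left (C Y : Finset ℝ) (x : ℝ) : rep C Y x ≤ C.card := by
  rw [rep_eq_card]; exact Finset.card_filter_le _ _

theorem rep_le_card_right (C Y : Finset ℝ) (x : ℝ) : rep C Y x ≤ Y.card := by
  rw [rep_comm]; exact rep_le_card_left _ _ _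

theorem rep_eq_zero {C Y : Finset ℝ} {x : ℝ} (h : x ∉ C + Y) : rep C Y x = 0 := by
  unfold rep
  rw [Finset.card_eq_zero, Finset.filter_eq_empty_iff]
  rintro ⟨c, y⟩ hp rfl
  rw [Finset.mem_product] at hp
  exact h (Finset.add_mem_add hp.1 hp.2)

theorem rep_mono {C C' Y Y' : Finset ℝ} (hC : C ⊆ C') (hY : Y ⊆ Y') (x : ℝ) :
    rep C Y x ≤ rep C' Y' x :=
  Finset.card_le_card (Finset.filter_subset_filter _ (Finset.product_subset_product hC hY))

theorem rep_neg_neg (C Y : Finset ℝ) (x : ℝ) : rep (-C) (-Y) (-x) = rep C Y x := by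
  unfold rep
  refine Finset.card_bij' (fun p _ => (-p.1, -p.2)) (fun p _ => (-p.1, -p.2)) ?_ ?_ ?_ ?_
  · rintro ⟨c, y⟩ h
    simp only [Finset.mem_filter, Finset.mem_product, Finset.mem_neg'] at h ⊢
    exact ⟨h.1, by linarith [h.2]⟩
  · rintro ⟨c, y⟩ h
    simp only [Finset.mem_filter, Finset.mem_product, Finset.mem_neg', neg_neg] at h ⊢
    exact ⟨h.1, by linarith [h.2]⟩
  · simp
  · simp

/-- Summing a function of `c + y` over `C × Y`. -/
theorem sum_add_eq_sum_rep {C Y Z : Finset ℝ} (hZ : C + Y ⊆ Z) (F : ℝ → ℝ) :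
    ∑ p ∈ C ×ˢ Y, F (p.1 + p.2) = ∑ x ∈ Z, (rep C Y x : ℝ) * F x := by
  have h : ∀ p ∈ C ×ˢ Y, p.1 + p.2 ∈ Z := fun p hp =>
    hZ (Finset.add_mem_add (Finset.mem_product.1 hp).1 (Finset.mem_product.1 hp).2)
  rw [← Finset.sum_fiberwise_of_maps_to h]
  refine Finset.sum_congr rfl fun x _ => ?_
  rw [Finset.sum_congr rfl (g := fun _ => F x)
    (fun p hp => by rw [(Finset.mem_filter.1 hp).2])]
  rw [Finset.sum_const, nsmul_eq_mul, rep]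

theorem sum_rep {C Y Z : Finset ℝ} (hZ : C + Y ⊆ Z) :
    ∑ x ∈ Z, (rep C Y x : ℝ) = C.card * Y.card := by
  have := sum_add_eq_sum_rep hZ (fun _ => 1)
  simp only [mul_one, Finset.sum_const, Finset.card_product, nsmul_eq_mul] at this
  rw [← this]; push_cast; ring

/-- Solutions of `x + z = y`, counted from the side of `Y` and from the side of `X`. -/
theorem sum_rep_swap (X Z Y : Finset ℝ) :
    ∑ y ∈ Y, rep X Z y = ∑ x ∈ X, rep (-Z) Y x := by
  simp only [rep_eq_card, Finset.card_filter]
  rw [Finset.sum_comm]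
  refine Finset.sum_congr rfl fun x _ => ?_
  rw [← Finset.card_filter, ← Finset.card_filter, ← rep_eq_card, rep_comm, rep_eq_card]
  congr 1
  ext y
  simp only [Finset.mem_filter, Finset.mem_neg']
  simp

theorem sumBound_neg {X : Finset ℝ} {l : ℝ} (h : SumBound X l) : SumBound (-X) l := by
  intro C Y
  have h1 := h (-C) (-Y)
  have h2 : gridSize (-C) (-Y) = gridSize C Y := by simp [gridSize]
  rw [h2] at h1
  refine le_trans (le_of_eq ?_) h1
  refine Finset.sum_nbij' (fun x => -x) (fun x => -x) ?_ ?_ ?_ ?_ ?_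
  · intro x hx; exact Finset.mem_neg'.1 hx
  · intro x hx; rw [Finset.mem_neg', neg_neg]; exact hx
  · simp
  · simp
  · intro x _; rw [rep_neg_neg]

theorem sumBound_mono {X : Finset ℝ} {l l' : ℝ} (h : SumBound X l) (hl : l ≤ l') :
    SumBound X l' := fun C Y =>
  (h C Y).trans (mul_le_mul_of_nonneg_right hl (gridSize_nonneg C Y))

theorem sumBound_union {X X' : Finset ℝ} {l l' : ℝ} (h : SumBound X l) (h' : SumBound X' l') :
    SumBound (X ∪ X') (l + l') := by
  intro C Y
  have h1 : ∑ x ∈ X ∪ X', (rep C Y x : ℝ) ≤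
      ∑ x ∈ X, (rep C Y x : ℝ) + ∑ x ∈ X', (rep C Y x : ℝ) := by
    rw [← Finset.sum_union_inter]
    have : 0 ≤ ∑ x ∈ X ∩ X', (rep C Y x : ℝ) := by positivity
    linarith
  calc _ ≤ _ := h1
    _ ≤ l * gridSize C Y + l' * gridSize C Y := add_le_add (h C Y) (h' C Y)
    _ = _ := by ring

/-- A single count is at most min(|C|, |Y|), which is at most (|C||Y|)^{2/3}. This trivial bound
starts the minimisation in `Curved.exists_halves`. -/
theorem sumBound_card (X : Finset ℝ) : SumBound X X.card := by
  intro C Y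
  have h : ∀ x ∈ X, (rep C Y x : ℝ) ≤ gridSize C Y := by
    intro x _
    have h1 : (rep C Y x : ℝ) ≤ C.card := by exact_mod_cast rep_le_card_left C Y x
    have h2 : (rep C Y x : ℝ) ≤ Y.card := by exact_mod_cast rep_le_card_right C Y x
    refine le_of_pow_le_pow_left₀ (n := 3) (by norm_num) (gridSize_nonneg C Y) ?_
    rw [gridSize_cube]
    rcases Nat.eq_zero_or_pos (rep C Y x) with h0 | h0
    · rw [h0]; simp; positivity
    have h0' : (1 : ℝ) ≤ rep C Y x := by exact_mod_cast h0
    have h3 : (rep C Y x : ℝ) * rep C Y x ≤ C.card * Y.card :=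
      mul_le_mul h1 h2 (by positivity) (by positivity)
    calc (rep C Y x : ℝ) ^ 3 ≤ (rep C Y x : ℝ) ^ 4 := pow_le_pow_right₀ h0' (by norm_num)
      _ = ((rep C Y x : ℝ) * rep C Y x) ^ 2 := by ring
      _ ≤ _ := by gcongr
  calc ∑ x ∈ X, (rep C Y x : ℝ) ≤ ∑ _x ∈ X, gridSize C Y := Finset.sum_le_sum h
    _ = _ := by simp

theorem one_le_of_sumBound {X : Finset ℝ} {l : ℝ} (hX : X.Nonempty) (h : SumBound X l) :
    1 ≤ l := by
  obtain ⟨x, hx⟩ := hX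
  have h1 := h {x} {0}
  have h2 : gridSize {x} {0} = 1 := by simp [gridSize]
  have h3 : (rep {x} {0} x : ℝ) = 1 := by simp [rep, Finset.filter_singleton]
  have h4 : (rep {x} {0} x : ℝ) ≤ ∑ z ∈ X, (rep {x} {0} z : ℝ) :=
    Finset.single_le_sum (f := fun z => (rep {x} {0} z : ℝ)) (fun _ _ => by positivity) hx
  rw [h2, mul_one] at h1
  linarith

/-! ### Level sets and third moments. -/

/-- A weak-type bound implies a strong-type bound with a logarithmic loss. -/
theorem sum_le_of_weak {ι : Type*} (s : Finset ι) (w : ι → ℝ) (hw : ∀ i ∈ s, 0 ≤ w i) {T : ℝ}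
    (hT : 0 ≤ T) (h : ∀ k > 0, k * ((s.filter fun i => k ≤ w i).card : ℝ) ≤ T) :
    ∑ i ∈ s, w i ≤ T * (1 + Real.log s.card) := by
  classical
  have key : ∀ n : ℕ, ∀ s : Finset ι, s.card = n → (∀ i ∈ s, 0 ≤ w i) →
      (∀ k > 0, k * ((s.filter fun i => k ≤ w i).card : ℝ) ≤ T) →
      ∑ i ∈ s, w i ≤ T * (harmonic n : ℝ) := by
    intro n
    induction n with
    | zero =>
      intro s hs _ _
      rw [Finset.card_eq_zero.1 hs]
      simp
    | succ n ih =>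
      intro s hs hw h
      -- The least of n + 1 weights w satisfies (n + 1) w ≤ T, by the weak bound at level w.
      -- Removing minima one by one sums to T times a harmonic number.
      obtain ⟨i, hi, hmin⟩ := s.exists_min_image w (Finset.card_pos.1 (by omega))
      have h1 := ih (s.erase i) (by rw [Finset.card_erase_of_mem hi]; omega)
        (fun j hj => hw j (Finset.mem_of_mem_erase hj)) (fun k hk => by
          refine le_trans ?_ (h k hk)
          gcongr
          exact Finset.erase_subset _ _)
      rw [← Finset.add_sum_erase s w hi, harmonic_succ]
      have h2 : w i ≤ T * (n + 1 : ℝ)⁻¹ := by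
        rcases (hw i hi).eq_or_lt with h0 | h0
        · rw [← h0]; positivity
        have h3 := h (w i) h0
        rw [Finset.filter_true_of_mem (fun j hj => hmin j hj), hs] at h3
        rw [← div_eq_mul_inv, le_div_iff₀ (by positivity)]
        exact_mod_cast h3
      push_cast
      linarith [mul_add T (harmonic n : ℝ) ((n : ℝ) + 1)⁻¹]
  refine (key _ s rfl hw h).trans (mul_le_mul_of_nonneg_left ?_ hT)
  exact_mod_cast harmonic_le_one_add_log s.card

/-- A popular level set carries a logarithmic proportion of the sum. -/
theorem exists_level {ι : Type*} (s : Finset ι) (w : ι → ℝ) (hw : ∀ i ∈ s, 0 ≤ w i)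
    (hpos : 0 < ∑ i ∈ s, w i) :
    ∃ k > 0, ∑ i ∈ s, w i ≤
      2 * (1 + Real.log s.card) * (k * ((s.filter fun i => k ≤ w i).card : ℝ)) := by
  by_contra! hcon
  have hlog : 0 ≤ Real.log s.card := Real.log_natCast_nonneg _
  -- If every level failed, the weak bound with this T would make the sum at most half of itself.
  have := sum_le_of_weak s w hw (T := (∑ i ∈ s, w i) / (2 * (1 + Real.log s.card)))
    (by positivity) (fun k hk => by
      rw [le_div_iff₀ (by positivity)]
      linarith [hcon k hk])
  rw [div_mul_eq_mul_div, le_div_iff₀ (by positivity)] at this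
  nlinarith

theorem holder_cube {ι : Type*} (s : Finset ι) (u v : ι → ℝ) (hu : ∀ i ∈ s, 0 ≤ u i)
    (hv : ∀ i ∈ s, 0 ≤ v i) :
    (∑ i ∈ s, u i * v i ^ 2) ^ 3 ≤ (∑ i ∈ s, u i ^ 3) * (∑ i ∈ s, v i ^ 3) ^ 2 := by
  have h := Real.inner_le_Lp_mul_Lq_of_nonneg s (p := 3) (q := 3 / 2)
    (by constructor <;> norm_num) hu (fun i hi => sq_nonneg (v i))
  have e1 : ∑ i ∈ s, u i ^ (3 : ℝ) = ∑ i ∈ s, u i ^ 3 :=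
    Finset.sum_congr rfl fun i _ => by norm_cast
  have e2 : ∑ i ∈ s, (v i ^ 2) ^ (3 / 2 : ℝ) = ∑ i ∈ s, v i ^ 3 :=
    Finset.sum_congr rfl fun i hi => by
      rw [← Real.rpow_natCast, ← Real.rpow_mul (hv i hi), ← Real.rpow_natCast]; norm_num
  rw [e1, e2] at h
  have hU : 0 ≤ ∑ i ∈ s, u i ^ 3 := Finset.sum_nonneg fun i hi => pow_nonneg (hu i hi) 3
  have hV : 0 ≤ ∑ i ∈ s, v i ^ 3 := Finset.sum_nonneg fun i hi => pow_nonneg (hv i hi) 3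
  have h0 : 0 ≤ ∑ i ∈ s, u i * v i ^ 2 :=
    Finset.sum_nonneg fun i hi => mul_nonneg (hu i hi) (sq_nonneg _)
  refine (pow_le_pow_left₀ h0 h 3).trans (le_of_eq ?_)
  rw [mul_pow, ← Real.rpow_natCast, ← Real.rpow_natCast, ← Real.rpow_mul hU,
    ← Real.rpow_mul hV, ← Real.rpow_natCast (_ : ℝ) 2]
  norm_num

/-- The third moment of the representation function. -/
theorem sum_rep_cube_le {X : Finset ℝ} {l : ℝ} (hl : 0 ≤ l) (hX : SumBound X l)
    (Z Y : Finset ℝ) :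
    ∑ y ∈ Y, (rep X Z y : ℝ) ^ 3 ≤
      l ^ 3 * (Z.card : ℝ) ^ 2 * (1 + Real.log ((X.card : ℝ) * Z.card)) := by
  have h1 : ∑ y ∈ Y, (rep X Z y : ℝ) ^ 3 ≤ ∑ y ∈ X + Z, (rep X Z y : ℝ) ^ 3 := by
    rw [← Finset.sum_filter_add_sum_filter_not Y (fun y => y ∈ X + Z)]
    have : ∑ y ∈ Y.filter (fun y => y ∉ X + Z), (rep X Z y : ℝ) ^ 3 = 0 :=
      Finset.sum_eq_zero fun y hy => by
        rw [rep_eq_zero (Finset.mem_filter.1 hy).2]; norm_num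
    rw [this, add_zero]
    exact Finset.sum_le_sum_of_subset_of_nonneg
      (fun y hy => (Finset.mem_filter.1 hy).2) (fun _ _ _ => by positivity)
  refine h1.trans ?_
  refine (sum_le_of_weak (X + Z) (fun y => (rep X Z y : ℝ) ^ 3) (fun _ _ => by positivity)
    (T := l ^ 3 * (Z.card : ℝ) ^ 2) (by positivity) ?_).trans ?_
  · intro k hk
    set Y₀ := (X + Z).filter fun y => k ≤ (rep X Z y : ℝ) ^ 3
    -- Reading x + z = y as x = -z + y moves the count onto X, where `SumBound` applies. Cubing then
    -- leaves one factor |Y₀| after cancellation.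
    have hY : ∑ y ∈ Y₀, (rep X Z y : ℝ) ≤ l * gridSize (-Z) Y₀ := by
      have := hX (-Z) Y₀
      have e := sum_rep_swap X Z Y₀
      have e' : ∑ y ∈ Y₀, (rep X Z y : ℝ) = ∑ x ∈ X, (rep (-Z) Y₀ x : ℝ) := by exact_mod_cast e
      rw [e']; exact this
    have hk3 : (k ^ (1 / 3 : ℝ)) ^ 3 = k := by
      rw [← Real.rpow_natCast, ← Real.rpow_mul hk.le]; norm_num
    have hk0 : 0 ≤ k ^ (1 / 3 : ℝ) := by positivity
    have h2 : (Y₀.card : ℝ) * k ^ (1 / 3 : ℝ) ≤ ∑ y ∈ Y₀, (rep X Z y : ℝ) := by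
      rw [← nsmul_eq_mul]
      refine Finset.card_nsmul_le_sum _ _ _ fun y hy => ?_
      refine le_of_pow_le_pow_left₀ (n := 3) (by norm_num) (by positivity) ?_
      rw [hk3]
      exact (Finset.mem_filter.1 hy).2
    have h3 := pow_le_pow_left₀ (by positivity) (h2.trans hY) 3
    rw [mul_pow, mul_pow, hk3, gridSize_cube, Finset.card_neg] at h3
    rcases Nat.eq_zero_or_pos Y₀.card with h0 | h0
    · rw [h0]; simp; positivity
    have h0' : (0 : ℝ) < (Y₀.card : ℝ) ^ 2 := by positivity
    refine le_of_mul_le_mul_right ?_ h0'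
    nlinarith
  · rcases Nat.eq_zero_or_pos (X + Z).card with h0 | h0
    · have hz : X = ∅ ∨ Z = ∅ := by
        simpa using h0
      rcases hz with rfl | rfl <;> simp
    gcongr
    exact_mod_cast Finset.card_add_le

/-! ### An incidence bound by cell decomposition. -/

/-- The number of elements of `C` below `c`. -/
noncomputable def rank (C : Finset ℝ) (c : ℝ) : ℕ := (C.filter fun x => x < c).card

theorem rank_mono (C : Finset ℝ) {c d : ℝ} (h : c ≤ d) : rank C c ≤ rank C d :=
  Finset.card_le_card fun x hx => by
    simp only [Finset.mem_filter] at hx ⊢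
    exact ⟨hx.1, hx.2.trans_le h⟩

theorem rank_lt_rank {C : Finset ℝ} {c d : ℝ} (hc : c ∈ C) (h : c < d) :
    rank C c < rank C d := by
  refine Finset.card_lt_card (Finset.ssubset_iff_of_subset ?_ |>.2 ⟨c, ?_, ?_⟩)
  · intro x hx
    simp only [Finset.mem_filter] at hx ⊢
    exact ⟨hx.1, hx.2.trans h⟩
  · simp [hc, h]
  · simp

theorem rank_lt_card {C : Finset ℝ} {c : ℝ} (hc : c ∈ C) : rank C c < C.card :=
  Finset.card_lt_card (Finset.filter_ssubset.2 ⟨c, hc, lt_irrefl c⟩)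

/-- The index of the block of `c` when `C` is cut into at most `r` intervals. -/
noncomputable def block (C : Finset ℝ) (r : ℕ) (c : ℝ) : ℕ := rank C c / (C.card / r + 1)

theorem block_mono (C : Finset ℝ) (r : ℕ) {c d : ℝ} (h : c ≤ d) : block C r c ≤ block C r d :=
  Nat.div_le_div_right (rank_mono C h)

/-- The block length ⌊|C|/r⌋ + 1 exceeds |C|/r, so r blocks suffice. -/
theorem block_lt {C : Finset ℝ} {r : ℕ} (hr : 0 < r) {c : ℝ} (hc : c ∈ C) : block C r c < r := by
  rw [block, Nat.div_lt_iff_lt_mul (Nat.succ_pos _)]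
  refine (rank_lt_card hc).trans ?_
  have := Nat.lt_div_mul_add (a := C.card) hr
  nlinarith

/-- The ordered pairs in a common block. -/
noncomputable def blockPairs (C : Finset ℝ) (r : ℕ) : Finset (ℝ × ℝ) :=
  (C ×ˢ C).filter fun p => p.1 < p.2 ∧ block C r p.1 = block C r p.2

/-- An element has at most ⌊|C|/r⌋ later elements in its block, one less than the block length. In
particular there are no pairs when |C| < r. -/
theorem card_blockPairs_le (C : Finset ℝ) (r : ℕ) :
    (blockPairs C r).card ≤ C.card * (C.card / r) := by
  have h : blockPairs C r ⊆ C.biUnion fun c =>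
      (C.filter fun d => c < d ∧ block C r c = block C r d).image fun d => (c, d) := by
    rintro ⟨c, d⟩ hp
    simp only [blockPairs, Finset.mem_filter, Finset.mem_product] at hp
    simp only [Finset.mem_biUnion, Finset.mem_image, Finset.mem_filter]
    exact ⟨c, hp.1.1, d, ⟨hp.1.2, hp.2⟩, rfl⟩
  refine (Finset.card_le_card h).trans (Finset.card_biUnion_le_card_mul _ _ _ fun c hc => ?_)
  refine Finset.card_image_le.trans ?_
  have h1 : (Finset.Ioo (rank C c) (rank C c + (C.card / r + 1))).card = C.card / r := by
    rw [Nat.card_Ioo, Nat.add_sub_cancel_left, Nat.add_sub_cancel]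
  rw [← h1]
  refine Finset.card_le_card_of_injOn (rank C) ?_ ?_
  · intro d hd
    simp only [Finset.coe_filter, Set.mem_ofPred_eq] at hd
    simp only [Finset.coe_Ioo, Set.mem_Ioo]
    refine ⟨rank_lt_rank hc hd.2.1, ?_⟩
    have h2 := hd.2.2
    unfold block at h2
    have h3 := Nat.div_mul_le_self (rank C c) (C.card / r + 1)
    have h4 := Nat.lt_div_mul_add (a := rank C d) (Nat.succ_pos (C.card / r))
    rw [Nat.succ_eq_add_one, ← h2] at h4
    omega
  · intro d hd e he hde
    simp only [Finset.coe_filter, Set.mem_ofPred_eq] at hd he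
    rcases lt_trichotomy d e with h2 | h2 | h2
    · exact absurd hde (rank_lt_rank hd.1 h2).ne
    · exact h2
    · exact absurd hde (rank_lt_rank he.1 h2).ne'

/-- The least elements of the fibres of ψ number at most m; any other element is the larger member
of a counted pair. -/
theorem card_le_add_card_pairs (s : Finset ℝ) (ψ : ℝ → ℕ) {m : ℕ} (h : ∀ x ∈ s, ψ x < m) :
    s.card ≤ m + ((s ×ˢ s).filter fun p => p.1 < p.2 ∧ ψ p.1 = ψ p.2).card := by
  classical
  rw [← Finset.card_filter_add_card_filter_not (s := s)
    (fun x => ∀ y ∈ s, y < x → ψ y ≠ ψ x)]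
  refine add_le_add ?_ ?_
  · rw [← Finset.card_range m]
    refine Finset.card_le_card_of_injOn ψ ?_ ?_
    · intro x hx
      simp only [Finset.coe_filter, Set.mem_ofPred_eq] at hx
      simpa using h x hx.1
    · intro x hx y hy hxy
      simp only [Finset.coe_filter, Set.mem_ofPred_eq] at hx hy
      by_contra hne
      rcases lt_or_gt_of_ne hne with h1 | h1
      · exact hy.2 x hx.1 h1 hxy
      · exact hx.2 y hy.1 h1 hxy.symm
  · refine le_trans (Finset.card_le_card ?_) (Finset.card_image_le (f := Prod.snd))
    intro x hx
    simp only [Finset.mem_filter, not_forall, not_not] at hx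
    obtain ⟨hx, y, hy, hlt, he⟩ := hx
    simp only [Finset.mem_image, Finset.mem_filter, Finset.mem_product]
    exact ⟨(y, x), ⟨⟨hy, hx⟩, hlt, he⟩, rfl⟩

/-- Distinct translates of the chords of `f` over `A` have distinct increments. -/
def ChordInjective (f : ℝ → ℝ) (A : Finset ℝ) : Prop :=
  ∀ s t h : ℝ, h ≠ 0 → s ∈ A → t ∈ A → s + h ∈ A → t + h ∈ A →
    f (s + h) - f s = f (t + h) - f t → s = t

theorem sum_rep_mul_rep_eq (f : ℝ → ℝ) (A C Y C' Y' : Finset ℝ) :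
    ∑ x ∈ A, rep C Y x * rep C' Y' (f x) =
      ∑ p ∈ Y ×ˢ Y', (A.filter fun x => x - p.1 ∈ C ∧ f x - p.2 ∈ C').card := by
  simp only [Finset.card_filter]
  rw [Finset.sum_comm]
  refine Finset.sum_congr rfl fun x _ => ?_
  rw [rep_comm C, rep_comm C', rep_eq_card, rep_eq_card, ← Finset.card_product,
    ← Finset.filter_product, ← Finset.card_filter]

/-- Each (y, y') gives a translate of an increasing graph, which meets fewer than 2r cells of the r
× r grid of blocks. Further incidences yield pairs in a common cell, and `ChordInjective` recovers
the translate from such a pair. -/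
theorem incidence_le (f : ℝ → ℝ) (A : Finset ℝ) (hmono : StrictMonoOn f A)
    (hinj : ChordInjective f A) (C Y C' Y' : Finset ℝ) {r : ℕ} (hr : 0 < r) :
    ∑ x ∈ A, rep C Y x * rep C' Y' (f x) ≤
      2 * r * (Y.card * Y'.card) + C.card * (C.card / r) * (C'.card * (C'.card / r)) := by
  classical
  rw [sum_rep_mul_rep_eq]
  set I : ℝ × ℝ → Finset ℝ := fun p => A.filter fun x => x - p.1 ∈ C ∧ f x - p.2 ∈ C' with hI
  set J : ℝ × ℝ → Finset (ℝ × ℝ) := fun p => (I p ×ˢ I p).filter fun q => q.1 < q.2 ∧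
    block C r (q.1 - p.1) + block C' r (f q.1 - p.2) =
      block C r (q.2 - p.1) + block C' r (f q.2 - p.2) with hJ
  have h1 : ∀ p ∈ Y ×ˢ Y', (I p).card ≤ 2 * r + (J p).card := by
    intro p _
    refine card_le_add_card_pairs (I p)
      (fun x => block C r (x - p.1) + block C' r (f x - p.2)) ?_
    intro x hx
    simp only [hI, Finset.mem_filter] at hx
    have h2 := block_lt hr hx.2.1
    have h3 := block_lt hr hx.2.2
    omega
  refine (Finset.sum_le_sum h1).trans ?_
  rw [Finset.sum_add_distrib, Finset.sum_const, Finset.card_product, smul_eq_mul, mul_comm _ (2 * r)]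
  refine Nat.add_le_add_left ?_ _
  rw [← Finset.card_sigma]
  refine le_trans ?_ (Nat.mul_le_mul (card_blockPairs_le C r) (card_blockPairs_le C' r))
  rw [← Finset.card_product]
  have hmem : ∀ z ∈ (Y ×ˢ Y').sigma J, z.2.1 ∈ A ∧ z.2.2 ∈ A ∧ z.2.1 < z.2.2 ∧
      z.2.1 - z.1.1 ∈ C ∧ z.2.2 - z.1.1 ∈ C ∧ f z.2.1 - z.1.2 ∈ C' ∧ f z.2.2 - z.1.2 ∈ C' ∧
      block C r (z.2.1 - z.1.1) + block C' r (f z.2.1 - z.1.2) =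
      block C r (z.2.2 - z.1.1) + block C' r (f z.2.2 - z.1.2) := by
    intro z hz
    simp only [hJ, hI, Finset.mem_sigma, Finset.mem_filter, Finset.mem_product] at hz
    tauto
  refine Finset.card_le_card_of_injOn
    (fun z => ((z.2.1 - z.1.1, z.2.2 - z.1.1), (f z.2.1 - z.1.2, f z.2.2 - z.1.2))) ?_ ?_
  · intro z hz
    obtain ⟨ha, hb, hlt, hc, hd, hc', hd', he⟩ := hmem z hz
    have hf := hmono ha hb hlt
    -- Both block indices are nondecreasing along the graph, so equality of their sums forces
    -- equality of each.
    have m1 := block_mono C r (c := z.2.1 - z.1.1) (d := z.2.2 - z.1.1) (by linarith)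
    have m2 := block_mono C' r (c := f z.2.1 - z.1.2) (d := f z.2.2 - z.1.2) (by linarith)
    simp only [Finset.coe_product, Set.mem_prod, Finset.mem_coe, blockPairs, Finset.mem_filter,
      Finset.mem_product]
    exact ⟨⟨⟨hc, hd⟩, by linarith, by omega⟩, ⟨hc', hd'⟩, by linarith, by omega⟩
  · rintro ⟨⟨y, y'⟩, ⟨x₁, x₂⟩⟩ hz ⟨⟨w, w'⟩, ⟨v₁, v₂⟩⟩ hw heq
    obtain ⟨ha, hb, hlt, -⟩ := hmem _ hz
    obtain ⟨ha', hb', -⟩ := hmem _ hw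
    simp only [Prod.mk.injEq] at heq ha hb hlt ha' hb'
    obtain ⟨⟨e1, e2⟩, e3, e4⟩ := heq
    have hv : v₂ = v₁ + (x₂ - x₁) := by linarith
    have hx : x₂ = x₁ + (x₂ - x₁) := by ring
    have := hinj x₁ v₁ (x₂ - x₁) (by linarith) ha ha' (by rwa [← hx]) (by rwa [← hv])
      (by rw [← hx, ← hv]; linarith)
    subst this
    have hy : y = w := by linarith
    have hy' : y' = w' := by linarith
    have hx2 : x₂ = v₂ := by linarith
    subst hy hy' hx2
    rfl

/-- With P = |C||C'| and L = |Y||Y'|, this optimises 2rL + P²/r² over r. The condition L ≤ P ensures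
that the optimum is at least 1. -/
theorem incidence_le_of_card_le (f : ℝ → ℝ) (A : Finset ℝ) (hmono : StrictMonoOn f A)
    (hinj : ChordInjective f A) (C Y C' Y' : Finset ℝ) (hpos : 0 < Y.card * Y'.card)
    (hle : Y.card * Y'.card ≤ C.card * C'.card) :
    ((∑ x ∈ A, rep C Y x * rep C' Y' (f x) : ℕ) : ℝ) ≤
      5 * (gridSize C Y * gridSize C' Y') := by
  set P : ℝ := (C.card : ℝ) * C'.card with hP
  set L : ℝ := (Y.card : ℝ) * Y'.card with hL
  have hL0 : 1 ≤ L := by rw [hL]; exact_mod_cast hpos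
  have hLP : L ≤ P := by rw [hL, hP]; exact_mod_cast hle
  have hP0 : 0 < P := by linarith
  set G : ℝ := gridSize C Y * gridSize C' Y' with hG
  have hG0 : 0 ≤ G := mul_nonneg (gridSize_nonneg _ _) (gridSize_nonneg _ _)
  have hG3 : G ^ 3 = P ^ 2 * L ^ 2 := by
    rw [hG, mul_pow, gridSize_cube, gridSize_cube]; ring
  have hGL : L ≤ G := by
    refine le_of_pow_le_pow_left₀ (n := 3) (by norm_num) hG0 ?_
    rw [hG3]
    nlinarith [mul_pos hP0 (by linarith : 0 < L), pow_le_pow_left₀ (by linarith) hLP 2,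
      sq_nonneg L, mul_nonneg (sq_nonneg L) (by nlinarith : 0 ≤ P ^ 2 - L)]
  -- Since G = (PL)^{2/3}, the choice r ≈ G/L balances rL against P²/r². Rounding up costs at most a
  -- factor 2, hence 4G + G.
  set r : ℕ := ⌈G / L⌉₊ with hr
  have hr1 : G / L ≤ r := Nat.le_ceil _
  have hGL1 : 1 ≤ G / L := by rw [le_div_iff₀ (by linarith)]; linarith
  have hr2 : (r : ℝ) ≤ 2 * (G / L) := by
    have := (Nat.ceil_lt_add_one (by linarith : 0 ≤ G / L)).le
    linarith
  have hr0 : 0 < r := by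
    have : (0 : ℝ) < r := by linarith
    exact_mod_cast this
  have hr0' : (0 : ℝ) < r := by exact_mod_cast hr0
  have h1 : ((∑ x ∈ A, rep C Y x * rep C' Y' (f x) : ℕ) : ℝ) ≤
      2 * r * L + P ^ 2 / (r : ℝ) ^ 2 := by
    have := incidence_le f A hmono hinj C Y C' Y' hr0
    refine (Nat.cast_le.2 this).trans ?_
    push_cast
    have d1 : ((C.card / r : ℕ) : ℝ) ≤ C.card / r := Nat.cast_div_le
    have d2 : ((C'.card / r : ℕ) : ℝ) ≤ C'.card / r := Nat.cast_div_le
    calc _ ≤ 2 * (r : ℝ) * L + C.card * (C.card / r) * (C'.card * (C'.card / r)) := by gcongr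
      _ = _ := by rw [hP]; field_simp
  have h2 : 2 * r * L ≤ 4 * G := by
    calc 2 * r * L ≤ 2 * (2 * (G / L)) * L := by gcongr
      _ = 4 * G := by field_simp; ring
  have h3 : P ^ 2 / (r : ℝ) ^ 2 ≤ G := by
    have hGp : 0 < G := by linarith
    calc P ^ 2 / (r : ℝ) ^ 2 ≤ P ^ 2 / (G / L) ^ 2 := by gcongr
      _ = P ^ 2 * L ^ 2 / G ^ 2 := by field_simp
      _ = G := by rw [← hG3]; field_simp
  linarith

/-! ### Strict convexity implies curvature on a large subset. -/

/-- `f` is curved on `A`: the graph of `f` over `A` has few incidences with sumset grids. -/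
def Curved (f : ℝ → ℝ) (A : Finset ℝ) : Prop :=
  ∀ C Y C' Y' : Finset ℝ, ∑ x ∈ A, (rep C Y x : ℝ) * (rep C' Y' (f x) : ℝ) ≤
    5 * (gridSize C Y * gridSize C' Y')

theorem gridSize_comm (C Y : Finset ℝ) : gridSize C Y = gridSize Y C := by
  rw [gridSize, gridSize, mul_comm]

/-- Interchanging C with Y and C' with Y' leaves both sides unchanged, so L ≤ P may be assumed. -/
theorem curved_of_strictMonoOn {f : ℝ → ℝ} {A : Finset ℝ} (hmono : StrictMonoOn f A)
    (hinj : ChordInjective f A) : Curved f A := by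
  intro C Y C' Y'
  have hcast : ∑ x ∈ A, (rep C Y x : ℝ) * (rep C' Y' (f x) : ℝ) =
      ((∑ x ∈ A, rep C Y x * rep C' Y' (f x) : ℕ) : ℝ) := by push_cast; rfl
  have hnn : 0 ≤ 5 * (gridSize C Y * gridSize C' Y') := by
    have := gridSize_nonneg C Y
    have := gridSize_nonneg C' Y'
    positivity
  by_cases hz : C.card * Y.card * (C'.card * Y'.card) = 0
  · refine le_trans (le_of_eq (Finset.sum_eq_zero fun x _ => ?_)) hnn
    have l1 := rep_le_card_left C Y x
    have l2 := rep_le_card_right C Y x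
    have l3 := rep_le_card_left C' Y' (f x)
    have l4 := rep_le_card_right C' Y' (f x)
    simp only [Nat.mul_eq_zero] at hz
    have : rep C Y x = 0 ∨ rep C' Y' (f x) = 0 := by omega
    rcases this with h | h <;> rw [h] <;> simp
  rw [hcast]
  have hz' : 0 < C.card * Y.card * (C'.card * Y'.card) := Nat.pos_of_ne_zero hz
  have p1 : 0 < C.card * C'.card := by
    by_contra hc
    simp only [not_lt, Nat.le_zero, Nat.mul_eq_zero] at hc
    rcases hc with h | h <;> simp [h] at hz
  have p2 : 0 < Y.card * Y'.card := by
    by_contra hc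
    simp only [not_lt, Nat.le_zero, Nat.mul_eq_zero] at hc
    rcases hc with h | h <;> simp [h] at hz
  rcases le_total (Y.card * Y'.card) (C.card * C'.card) with h | h
  · exact incidence_le_of_card_le f A hmono hinj C Y C' Y' p2 h
  · have := incidence_le_of_card_le f A hmono hinj Y C Y' C' p1 h
    simpa only [rep_comm Y C, rep_comm Y' C', gridSize_comm Y C, gridSize_comm Y' C'] using this

theorem curved_neg {f : ℝ → ℝ} {A : Finset ℝ} (h : Curved (fun x => -f x) A) : Curved f A := by
  intro C Y C' Y'
  have := h C Y (-C') (-Y')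
  have e : gridSize (-C') (-Y') = gridSize C' Y' := by simp [gridSize]
  simpa only [rep_neg_neg, e] using this

theorem ChordInjective.neg {f : ℝ → ℝ} {A : Finset ℝ} (h : ChordInjective f A) :
    ChordInjective (fun x => -f x) A := fun s t k hk hs ht hs' ht' he =>
  h s t k hk hs ht hs' ht' (by linarith)

theorem curved_of_strictAntiOn {f : ℝ → ℝ} {A : Finset ℝ} (hanti : StrictAntiOn f A)
    (hinj : ChordInjective f A) : Curved f A :=
  curved_neg (curved_of_strictMonoOn (fun _ hx _ hy hxy => neg_lt_neg (hanti hx hy hxy)) hinj.neg)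

/-- Both s + h and t are convex combinations of s and t + h, with interchanged weights; adding the
two convexity inequalities gives the claim. -/
theorem StrictConvexOn.chord_lt {I : Set ℝ} {f : ℝ → ℝ} (hf : StrictConvexOn ℝ I f)
    {s t h : ℝ} (hh : 0 < h) (hst : s < t) (hs : s ∈ I) (ht : t + h ∈ I) :
    f (s + h) - f s < f (t + h) - f t := by
  have hd : 0 < t + h - s := by linarith
  have ha : 0 < (t - s) / (t + h - s) := div_pos (by linarith) hd
  have hb : 0 < h / (t + h - s) := div_pos hh hd
  have e3 : (t - s) / (t + h - s) + h / (t + h - s) = 1 := by field_simp; ring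
  have hne : s ≠ t + h := by linarith
  have h1 := hf.2 hs ht hne ha hb e3
  have h2 := hf.2 hs ht hne hb ha (by rw [add_comm]; exact e3)
  have e1 : ((t - s) / (t + h - s)) • s + (h / (t + h - s)) • (t + h) = s + h := by
    simp only [smul_eq_mul]; field_simp; ring
  have e2 : (h / (t + h - s)) • s + ((t - s) / (t + h - s)) • (t + h) = t := by
    simp only [smul_eq_mul]; field_simp; ring
  rw [e1] at h1
  rw [e2] at h2
  simp only [smul_eq_mul] at h1 h2
  have e4 : (t - s) / (t + h - s) = 1 - h / (t + h - s) := by linarith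
  rw [e4] at h1 h2
  linarith

theorem StrictConvexOn.chordInjective {I : Set ℝ} {f : ℝ → ℝ} (hf : StrictConvexOn ℝ I f)
    {A : Finset ℝ} (hA : (A : Set ℝ) ⊆ I) : ChordInjective f A := by
  have key : ∀ s t h : ℝ, 0 < h → s ∈ A → t ∈ A → s + h ∈ A → t + h ∈ A →
      f (s + h) - f s = f (t + h) - f t → s = t := by
    intro s t h hh hs ht hs' ht' he
    rcases lt_trichotomy s t with h1 | h1 | h1
    · exact absurd he (hf.chord_lt hh h1 (hA hs) (hA ht')).ne
    · exact h1
    · exact absurd he (hf.chord_lt hh h1 (hA ht) (hA hs')).ne'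
  intro s t h hh hs ht hs' ht' he
  rcases lt_or_gt_of_ne hh with h1 | h1
  · have := key (s + h) (t + h) (-h) (by linarith) hs' ht' (by simpa using hs)
      (by simpa using ht) (by simp only [add_neg_cancel_right]; linarith)
    linarith
  · exact key s t h h1 hs ht hs' ht' he

/-- Cutting at a minimum point m of f on A leaves a decreasing part, {m} and an increasing part. One
of the three contains a third of A. -/
theorem StrictConvexOn.exists_curved {I : Set ℝ} {f : ℝ → ℝ} (hf : StrictConvexOn ℝ I f)
    (A : Finset ℝ) (hA : (A : Set ℝ) ⊆ I) :
    ∃ A' ⊆ A, A.card ≤ 3 * A'.card ∧ Set.InjOn f A' ∧ Curved f A' := by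
  rcases A.eq_empty_or_nonempty with rfl | hne
  · exact ⟨∅, le_rfl, by simp, by simp, curved_of_strictMonoOn (by simp [StrictMonoOn])
      (by intro s t h _ hs; simp at hs)⟩
  obtain ⟨m, hm, hmin⟩ := A.exists_min_image f hne
  have hsub : ∀ p : ℝ → Prop, ∀ [DecidablePred p], ((A.filter p : Finset ℝ) : Set ℝ) ⊆ I :=
    fun p _ x hx => hA (Finset.mem_filter.1 hx).1
  have hR : StrictMonoOn f (A.filter fun x => m < x) := by
    intro x hx y hy hxy
    simp only [Finset.coe_filter, Set.mem_ofPred_eq] at hx hy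
    have := hf.lt_on_openSegment (hA hm) (hA hy.1) (by linarith [hx.2])
      (by rw [openSegment_eq_Ioo (by linarith [hx.2])]; exact ⟨hx.2, hxy⟩)
    rwa [max_eq_right (hmin y hy.1)] at this
  have hL : StrictAntiOn f (A.filter fun x => x < m) := by
    intro x hx y hy hxy
    simp only [Finset.coe_filter, Set.mem_ofPred_eq] at hx hy
    have := hf.lt_on_openSegment (hA hx.1) (hA hm) (by linarith [hx.2])
      (by rw [openSegment_eq_Ioo (by linarith [hx.2])]; exact ⟨hxy, hy.2⟩)
    rwa [max_eq_left (hmin x hx.1)] at this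
  have hcard : A.card ≤ (A.filter fun x => x < m).card + 1 + (A.filter fun x => m < x).card := by
    have : A ⊆ (A.filter fun x => x < m) ∪ {m} ∪ (A.filter fun x => m < x) := by
      intro x hx
      simp only [Finset.mem_union, Finset.mem_filter, Finset.mem_singleton, hx, true_and]
      rcases lt_trichotomy x m with h | h | h <;> tauto
    refine (Finset.card_le_card this).trans ((Finset.card_union_le _ _).trans ?_)
    gcongr
    exact Finset.card_union_le _ _
  by_cases h1 : A.card ≤ 3 * (A.filter fun x => x < m).card
  · exact ⟨_, Finset.filter_subset _ _, h1, hL.injOn,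
      curved_of_strictAntiOn hL (hf.chordInjective (hsub _))⟩
  by_cases h2 : A.card ≤ 3 * (A.filter fun x => m < x).card
  · exact ⟨_, Finset.filter_subset _ _, h2, hR.injOn,
      curved_of_strictMonoOn hR (hf.chordInjective (hsub _))⟩
  refine ⟨{m}, by simpa using hm, by simp; omega, by simp, curved_of_strictMonoOn (by simp)
    (hf.chordInjective (by simpa using hA hm))⟩

theorem exists_curved {I : Set ℝ} {f : ℝ → ℝ}
    (hf : StrictConvexOn ℝ I f ∨ StrictConcaveOn ℝ I f) (A : Finset ℝ) (hA : (A : Set ℝ) ⊆ I) :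
    ∃ A' ⊆ A, A.card ≤ 3 * A'.card ∧ Set.InjOn f A' ∧ Curved f A' := by
  rcases hf with hf | hf
  · exact hf.exists_curved A hA
  · obtain ⟨A', h1, h2, h3, h4⟩ := hf.neg.exists_curved A hA
    exact ⟨A', h1, h2, fun x hx y hy hxy => h3 hx hy (by simp [hxy]), curved_neg h4⟩

theorem sumBound_empty (l : ℝ) (hl : 0 ≤ l) : SumBound ∅ l := fun C Y => by
  simpa using mul_nonneg hl (gridSize_nonneg C Y)

/-! ### Balanced halves of a curved set. -/

/-- A set over which `f` is curved has a half with few additive representations, and a half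
whose image has few additive representations, in a balanced way. -/
theorem Curved.exists_halves {f : ℝ → ℝ} {A : Finset ℝ} (hA : A.Nonempty)
    (hinj : Set.InjOn f A) (hc : Curved f A) :
    ∃ X ⊆ A, ∃ Y ⊆ A, ∃ l m : ℝ, 0 ≤ l ∧ 0 ≤ m ∧ A.card ≤ 2 * X.card ∧ A.card ≤ 2 * Y.card ∧
      SumBound X l ∧ SumBound (Y.image f) m ∧
      l * m ≤ 20 * (1 + Real.log A.card) * A.card := by
  classical
  have hlog : 0 ≤ Real.log A.card := Real.log_natCast_nonneg _
  set H : ℝ := 1 + Real.log A.card with hH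
  have hex : ∃ k : ℕ, ∃ X ⊆ A, A.card ≤ 2 * X.card ∧ SumBound X k :=
    ⟨A.card, A, le_rfl, by omega, sumBound_card A⟩
  obtain ⟨k, ⟨X, hXA, hX2, hXb⟩, hkmin⟩ :
      ∃ k : ℕ, (∃ X ⊆ A, A.card ≤ 2 * X.card ∧ SumBound X k) ∧
        ∀ j < k, ¬ ∃ X ⊆ A, A.card ≤ 2 * X.card ∧ SumBound X j :=
    ⟨Nat.find hex, Nat.find_spec hex, fun j hj => Nat.find_min hex hj⟩
  have hApos : 0 < A.card := Finset.card_pos.2 hA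
  have hk1 : (1 : ℝ) ≤ k := one_le_of_sumBound (Finset.card_pos.1 (by omega)) hXb
  have hk0 : (0 : ℝ) < k := by linarith
  -- As k is a minimal integer, k/2 fails too: k - 1 ≥ k/2 if k ≥ 2, and no nonempty set has
  -- constant 1/2.
  have hfail : ∀ X ⊆ A, A.card ≤ 2 * X.card → ¬ SumBound X (k / 2) := by
    intro Z hZA hZ2 hZb
    have hk1' : 1 ≤ k := by exact_mod_cast hk1
    rcases hk1'.eq_or_lt with h1 | h1
    · have := one_le_of_sumBound (Finset.card_pos.1 (by omega)) hZb
      rw [← h1] at this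
      norm_num at this
    · refine hkmin (k - 1) (by omega) ⟨Z, hZA, hZ2, sumBound_mono hZb ?_⟩
      rw [Nat.cast_sub hk1']
      have : (2 : ℝ) ≤ k := by exact_mod_cast h1
      push_cast
      linarith
  set c : ℝ := 20 * H / k with hcdef
  have hc0 : 0 ≤ c := by positivity
  -- The allowed constant is proportional to |Y|, so it adds up over disjoint unions and a maximal Y
  -- can be extended.
  set 𝒴 : Finset (Finset ℝ) := A.powerset.filter fun Y => SumBound (Y.image f) (c * Y.card)
  have h𝒴 : 𝒴.Nonempty :=
    ⟨∅, Finset.mem_filter.2 ⟨by simp, by simpa using sumBound_empty 0 le_rfl⟩⟩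
  obtain ⟨Y, hY, hYmax⟩ := 𝒴.exists_max_image Finset.card h𝒴
  obtain ⟨hYA, hYb⟩ := Finset.mem_filter.1 hY
  rw [Finset.mem_powerset] at hYA
  have hY2 : A.card ≤ 2 * Y.card := by
    by_contra hlt
    have hcardX : (A \ Y).card = A.card - Y.card := Finset.card_sdiff_of_subset hYA
    have hno := hfail (A \ Y) Finset.sdiff_subset (by omega)
    simp only [SumBound, not_forall, not_le] at hno
    obtain ⟨C, Z, hCZ⟩ := hno
    have hpos : 0 < ∑ x ∈ A \ Y, (rep C Z x : ℝ) :=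
      lt_of_le_of_lt (by have := gridSize_nonneg C Z; positivity) hCZ
    -- If |Y| < |A|/2, the complement violates constant k/2 for some C, Z. On a rich level set X' of
    -- r_{C+Z}, curvature bounds the counts at f(x), so Y ∪ X' contradicts maximality.
    obtain ⟨t, ht, hlev⟩ := exists_level (A \ Y) (fun x => (rep C Z x : ℝ))
      (fun _ _ => by positivity) hpos
    set X' := (A \ Y).filter fun x => t ≤ (rep C Z x : ℝ) with hX'
    have hX'A : X' ⊆ A := (Finset.filter_subset _ _).trans Finset.sdiff_subset
    have hdisj : Disjoint Y X' :=
      Finset.disjoint_of_subset_right (Finset.filter_subset _ _) Finset.disjoint_sdiff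
    have hsdpos : 0 < (A \ Y).card := by omega
    have hH' : 1 + Real.log (A \ Y).card ≤ H := by
      rw [hH]
      gcongr
      exact Finset.sdiff_subset
    have hX'0 : 0 < X'.card := by
      rcases Nat.eq_zero_or_pos X'.card with h0 | h0
      · rw [h0] at hlev
        simp at hlev
        linarith
      · exact h0
    have hg0 : 0 < gridSize C Z := by
      rcases (gridSize_nonneg C Z).eq_or_lt with h0 | h0
      · exfalso
        have h3 := gridSize_cube C Z
        rw [← h0] at h3
        have h4 : (C.card : ℝ) * Z.card = 0 := by
          have : ((C.card : ℝ) * Z.card) ^ 2 = 0 := by rw [← h3]; norm_num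
          simpa using this
        have h5 : ∀ x ∈ A \ Y, (rep C Z x : ℝ) = 0 := by
          intro x _
          have l1 := rep_le_card_left C Z x
          have l2 := rep_le_card_right C Z x
          have h6 : C.card * Z.card = 0 := by exact_mod_cast h4
          rw [Nat.mul_eq_zero] at h6
          have : rep C Z x = 0 := by omega
          rw [this]; simp
        rw [Finset.sum_eq_zero h5] at hpos
        exact lt_irrefl _ hpos
      · exact h0
    have hb : SumBound (X'.image f) (c * X'.card) := by
      intro C' Z'
      rw [Finset.sum_image (fun x hx y hy hxy => hinj (hX'A hx) (hX'A hy) hxy)]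
      have h1 : t * ∑ x ∈ X', (rep C' Z' (f x) : ℝ) ≤ 5 * (gridSize C Z * gridSize C' Z') := by
        rw [Finset.mul_sum]
        refine le_trans (Finset.sum_le_sum (g := fun x => (rep C Z x : ℝ) * rep C' Z' (f x))
          fun x hx => ?_) ?_
        · exact mul_le_mul_of_nonneg_right (Finset.mem_filter.1 hx).2 (by positivity)
        · exact (Finset.sum_le_sum_of_subset_of_nonneg hX'A
            (fun _ _ _ => by positivity)).trans (hc C Z C' Z')
      have h2 : (k : ℝ) / 2 * gridSize C Z ≤ 2 * H * (t * X'.card) := by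
        refine hCZ.le.trans (hlev.trans ?_)
        gcongr
      have hg' := gridSize_nonneg C' Z'
      set R := ∑ x ∈ X', (rep C' Z' (f x) : ℝ)
      have hgt : 0 < gridSize C Z * t := mul_pos hg0 ht
      have h3 : (k : ℝ) * (gridSize C Z * t) * R ≤
          20 * H * X'.card * gridSize C' Z' * (gridSize C Z * t) := by
        have e1 : (k : ℝ) * gridSize C Z * (t * R) ≤
            (k : ℝ) * gridSize C Z * (5 * (gridSize C Z * gridSize C' Z')) :=
          mul_le_mul_of_nonneg_left h1 (by positivity)
        have e2 : (k : ℝ) / 2 * gridSize C Z * (10 * (gridSize C Z * gridSize C' Z')) ≤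
            2 * H * (t * X'.card) * (10 * (gridSize C Z * gridSize C' Z')) :=
          mul_le_mul_of_nonneg_right h2 (by positivity)
        linarith
      have h4 : (k : ℝ) * R ≤ 20 * H * X'.card * gridSize C' Z' :=
        le_of_mul_le_mul_right (by linarith) hgt
      rw [hcdef, div_mul_eq_mul_div, div_mul_eq_mul_div, le_div_iff₀ hk0]
      linarith
    have hmem : Y ∪ X' ∈ 𝒴 := by
      refine Finset.mem_filter.2 ⟨Finset.mem_powerset.2 (Finset.union_subset hYA hX'A), ?_⟩
      rw [Finset.image_union, Finset.card_union_of_disjoint hdisj]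
      refine sumBound_mono (sumBound_union hYb hb) (le_of_eq ?_)
      push_cast; ring
    have := hYmax _ hmem
    rw [Finset.card_union_of_disjoint hdisj] at this
    omega
  refine ⟨X, hXA, Y, hYA, k, c * Y.card, hk0.le, by positivity, hX2, hY2, hXb, hYb, ?_⟩
  calc (k : ℝ) * (c * Y.card) = 20 * H * Y.card := by rw [hcdef]; field_simp
    _ ≤ 20 * H * A.card := by
      have : (Y.card : ℝ) ≤ A.card := by exact_mod_cast Finset.card_le_card hYA
      gcongr

/-! ### Popular sums and pairs with prescribed differences. -/

/-- The third moments control the number of coincidences `s - s' = x - y`. -/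
theorem sum_rep_mul_rep_pow_le {A B S D : Finset ℝ} {l m h : ℝ} (hl : 0 ≤ l) (hm : 0 ≤ m)
    (hA : SumBound A l) (hB : SumBound B m)
    (hh₁ : 1 + Real.log ((A.card : ℝ) * D.card) ≤ h)
    (hh₂ : 1 + Real.log ((B.card : ℝ) * S.card) ≤ h) :
    (∑ y ∈ A + -D, (rep A (-D) y : ℝ) * rep S (-B) y) ^ 6 ≤
      ((A.card : ℝ) * D.card) ^ 3 * (l ^ 3 * (D.card : ℝ) ^ 2 * h) *
        (m ^ 3 * (S.card : ℝ) ^ 2 * h) ^ 2 := by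
  set Z := A + -D
  -- Cauchy–Schwarz with weight r_{A-D} splits off the total mass |A||D|; Hölder with exponents 3
  -- and 3/2 then leaves only third moments.
  have h1 : (∑ y ∈ Z, (rep A (-D) y : ℝ) * rep S (-B) y) ^ 2 ≤
      (∑ y ∈ Z, (rep A (-D) y : ℝ)) * ∑ y ∈ Z, (rep A (-D) y : ℝ) * (rep S (-B) y : ℝ) ^ 2 :=
    Finset.sum_sq_le_sum_mul_sum_of_sq_le_mul _ (fun _ _ => by positivity)
      (fun _ _ => by positivity) (fun _ _ => le_of_eq (by ring))
  have h2 := holder_cube Z (fun y => (rep A (-D) y : ℝ)) (fun y => (rep S (-B) y : ℝ))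
    (fun _ _ => by positivity) (fun _ _ => by positivity)
  have h3 : ∑ y ∈ Z, (rep A (-D) y : ℝ) = A.card * D.card := by
    rw [sum_rep (le_refl (A + -D)), Finset.card_neg]
  have h4 : ∑ y ∈ Z, (rep A (-D) y : ℝ) ^ 3 ≤ l ^ 3 * (D.card : ℝ) ^ 2 * h := by
    have := sum_rep_cube_le hl hA (-D) Z
    rw [Finset.card_neg] at this
    refine this.trans ?_
    gcongr
  have h5 : ∑ y ∈ Z, (rep S (-B) y : ℝ) ^ 3 ≤ m ^ 3 * (S.card : ℝ) ^ 2 * h := by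
    have := sum_rep_cube_le hm (sumBound_neg hB) S Z
    rw [Finset.card_neg] at this
    simp only [rep_comm S]
    refine this.trans ?_
    gcongr
  have n4 : 0 ≤ ∑ y ∈ Z, (rep A (-D) y : ℝ) ^ 3 := by positivity
  have n5 : 0 ≤ ∑ y ∈ Z, (rep S (-B) y : ℝ) ^ 3 := by positivity
  have n6 := n4.trans h4
  rw [h3] at h1
  calc (∑ y ∈ Z, (rep A (-D) y : ℝ) * rep S (-B) y) ^ 6
      = ((∑ y ∈ Z, (rep A (-D) y : ℝ) * rep S (-B) y) ^ 2) ^ 3 := by ring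
    _ ≤ ((A.card : ℝ) * D.card *
          ∑ y ∈ Z, (rep A (-D) y : ℝ) * (rep S (-B) y : ℝ) ^ 2) ^ 3 := by gcongr
    _ = ((A.card : ℝ) * D.card) ^ 3 *
          (∑ y ∈ Z, (rep A (-D) y : ℝ) * (rep S (-B) y : ℝ) ^ 2) ^ 3 := by ring
    _ ≤ ((A.card : ℝ) * D.card) ^ 3 * ((∑ y ∈ Z, (rep A (-D) y : ℝ) ^ 3) *
          (∑ y ∈ Z, (rep S (-B) y : ℝ) ^ 3) ^ 2) := by gcongr
    _ ≤ ((A.card : ℝ) * D.card) ^ 3 * ((l ^ 3 * (D.card : ℝ) ^ 2 * h) *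
          (m ^ 3 * (S.card : ℝ) ^ 2 * h) ^ 2) := by gcongr
    _ = _ := by ring

/-- The number of `b ∈ B` with `q.1 - b` and `q.2 - b` in `A`. -/
noncomputable def commonShifts (A B : Finset ℝ) (q : ℝ × ℝ) : ℕ :=
  (B.filter fun b => q.1 - b ∈ A ∧ q.2 - b ∈ A).card

/-- Two shifts b, b' of the same q give the differences (q.1 - b') - (q.1 - b) and (q.2 - b') - (q.2
- b) in A - A, both equal to b - b'. -/
theorem sum_commonShifts_sq_le (A B S : Finset ℝ) :
    ∑ q ∈ S ×ˢ S, (commonShifts A B q : ℝ) ^ 2 ≤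
      ∑ t ∈ B + -B, (rep B (-B) t : ℝ) * (rep A (-A) t : ℝ) ^ 2 := by
  classical
  have h1 : ∑ q ∈ S ×ˢ S, commonShifts A B q ^ 2 ≤
      ∑ p ∈ B ×ˢ (-B), rep A (-A) (p.1 + p.2) ^ 2 := by
    have e : ∀ q, commonShifts A B q ^ 2 = ((B ×ˢ (-B)).filter fun p =>
        (q.1 - p.1 ∈ A ∧ q.2 - p.1 ∈ A) ∧ (q.1 + p.2 ∈ A ∧ q.2 + p.2 ∈ A)).card := by
      intro q
      rw [Finset.filter_product (fun b => q.1 - b ∈ A ∧ q.2 - b ∈ A)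
        (fun b => q.1 + b ∈ A ∧ q.2 + b ∈ A), Finset.card_product, sq, commonShifts]
      congr 1
      refine Finset.card_bij' (fun b _ => -b) (fun b _ => -b) ?_ ?_ ?_ ?_
      · intro b hb
        simp only [Finset.mem_filter, Finset.mem_neg', neg_neg] at hb ⊢
        simpa only [← sub_eq_add_neg] using hb
      · intro b hb
        simp only [Finset.mem_filter, Finset.mem_neg'] at hb ⊢
        simpa only [sub_neg_eq_add] using hb
      · simp
      · simp
    simp only [e, Finset.card_filter]
    rw [Finset.sum_comm]
    refine Finset.sum_le_sum fun p _ => ?_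
    rw [← Finset.card_filter, sq, rep_eq_card, ← Finset.card_product]
    refine Finset.card_le_card_of_injOn (fun q => (q.1 + p.2, q.2 + p.2)) ?_ ?_
    · intro q hq
      simp only [Finset.coe_filter, Set.mem_ofPred_eq] at hq
      have e1 : -(p.1 + p.2 - (q.1 + p.2)) = q.1 - p.1 := by ring
      have e2 : -(p.1 + p.2 - (q.2 + p.2)) = q.2 - p.1 := by ring
      simp only [Finset.coe_product, Set.mem_prod, Finset.mem_coe, Finset.mem_filter,
        Finset.mem_neg', e1, e2]
      tauto
    · rintro ⟨a, b⟩ _ ⟨c, d⟩ _ he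
      simpa using he
  have h2 := sum_add_eq_sum_rep (le_refl (B + -B)) (fun t => (rep A (-A) t : ℝ) ^ 2)
  rw [← h2]
  exact_mod_cast h1

/-- The sums in `A + B` with at least a constant proportion of the average number of
representations. -/
noncomputable def popularSums (A B : Finset ℝ) : Finset ℝ :=
  (A + B).filter fun s => A.card * B.card ≤ 16 * ((A + B).card * rep A B s)

/-- The elements of `A` most of whose sums with `B` are popular. -/
noncomputable def popularPart (A B : Finset ℝ) : Finset ℝ :=
  A.filter fun a => 3 * B.card ≤ 4 * (B.filter fun b => a + b ∈ popularSums A B).card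

theorem popularPart_subset (A B : Finset ℝ) : popularPart A B ⊆ A := Finset.filter_subset _ _

/-- Unpopular sums carry at most |A||B|/16 pairs, while each a outside the popular part lies in more
than |B|/4 of them. -/
theorem card_le_popularPart (A B : Finset ℝ) (hB : B.Nonempty) :
    3 * A.card ≤ 4 * (popularPart A B).card := by
  classical
  rcases A.eq_empty_or_nonempty with rfl | hA
  · simp
  set P := popularSums A B with hP
  set U := A.filter fun a => ¬ 3 * B.card ≤ 4 * (B.filter fun b => a + b ∈ P).card with hU
  have hsplit : (popularPart A B).card + U.card = A.card :=
    Finset.card_filter_add_card_filter_not _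
  have hS : 0 < (A + B).card := Finset.card_pos.2 (hA.add hB)
  have h1 : U.card * B.card ≤ 4 * ∑ a ∈ U, (B.filter fun b => a + b ∉ P).card := by
    rw [Finset.mul_sum, ← smul_eq_mul]
    refine Finset.card_nsmul_le_sum _ _ _ fun a ha => ?_
    have h2 := (Finset.mem_filter.1 ha).2
    have h3 := Finset.card_filter_add_card_filter_not (s := B) (fun b => a + b ∈ P)
    omega
  have h2 : ∑ a ∈ U, (B.filter fun b => a + b ∉ P).card ≤
      ∑ s ∈ (A + B) \ P, rep A B s := by
    calc _ ≤ ∑ a ∈ A, (B.filter fun b => a + b ∉ P).card :=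
          Finset.sum_le_sum_of_subset (Finset.filter_subset _ _)
      _ = ((A ×ˢ B).filter fun p => p.1 + p.2 ∉ P).card := by
          simp only [Finset.card_filter, Finset.sum_product]
      _ = _ := by
          rw [Finset.card_eq_sum_card_fiberwise (f := fun p => p.1 + p.2)
            (t := (A + B) \ P)]
          · refine Finset.sum_congr rfl fun s hs => ?_
            rw [rep, Finset.filter_filter]
            congr 1
            refine Finset.filter_congr fun p _ => ?_
            rw [Finset.mem_sdiff] at hs
            constructor
            · exact fun h => h.2
            · rintro rfl
              exact ⟨hs.2, rfl⟩
          · intro p hp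
            simp only [Finset.coe_filter, Set.mem_ofPred_eq, Finset.mem_product] at hp
            simp only [Finset.coe_sdiff, Set.mem_sdiff, Finset.mem_coe]
            exact ⟨Finset.add_mem_add hp.1.1 hp.1.2, hp.2⟩
  have h3 : 16 * ((A + B).card * ∑ s ∈ (A + B) \ P, rep A B s) ≤
      (A + B).card * (A.card * B.card) := by
    rw [Finset.mul_sum, Finset.mul_sum]
    refine (Finset.sum_le_card_nsmul _ _ (A.card * B.card) fun s hs => ?_).trans ?_
    · rw [Finset.mem_sdiff, hP, popularSums, Finset.mem_filter] at hs
      have := hs.2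
      simp only [hs.1, true_and, not_le] at this
      exact this.le
    · rw [smul_eq_mul]
      exact Nat.mul_le_mul_right _ (Finset.card_le_card Finset.sdiff_subset)
  have h4 : 16 * ∑ s ∈ (A + B) \ P, rep A B s ≤ A.card * B.card := by
    refine Nat.le_of_mul_le_mul_left ?_ hS
    linarith
  have hB0 : 0 < B.card := Finset.card_pos.2 hB
  have h5 : 4 * U.card ≤ A.card := by
    refine Nat.le_of_mul_le_mul_right ?_ hB0
    linarith
  omega

/-- The number of pairs of `G` with difference in `D`. -/
noncomputable def pairsIn (G D : Finset ℝ) : Finset (ℝ × ℝ) :=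
  (G ×ˢ G).filter fun p => p.1 - p.2 ∈ D

theorem card_pairsIn (G D : Finset ℝ) : (pairsIn G D).card = ∑ x ∈ D, rep G (-G) x := by
  have h : ∀ p ∈ pairsIn G D, p.1 - p.2 ∈ D := fun p hp => (Finset.mem_filter.1 hp).2
  rw [Finset.card_eq_sum_card_fiberwise h]
  refine Finset.sum_congr rfl fun x hx => ?_
  rw [pairsIn, Finset.filter_filter, rep]
  refine Finset.card_bij' (fun p _ => (p.1, -p.2)) (fun p _ => (p.1, -p.2)) ?_ ?_ ?_ ?_
  · rintro ⟨a, b⟩ hp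
    simp only [Finset.mem_filter, Finset.mem_product, Finset.mem_neg', neg_neg] at hp ⊢
    exact ⟨hp.1, by linarith [hp.2.2]⟩
  · rintro ⟨a, b⟩ hp
    simp only [Finset.mem_filter, Finset.mem_product, Finset.mem_neg', sub_neg_eq_add] at hp ⊢
    exact ⟨hp.1, hp.2 ▸ hx, hp.2⟩
  · simp
  · simp

/-- Two popular elements each have popular sums with three quarters of B, hence with a common half.
Shifting by such b preserves the difference. -/
theorem card_pairsIn_le_sum_commonShifts (A B D : Finset ℝ) :
    (pairsIn (popularPart A B) D).card * B.card ≤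
      2 * ∑ q ∈ pairsIn (popularSums A B) D, commonShifts A B q := by
  classical
  set P := popularSums A B with hP
  have h1 : (pairsIn (popularPart A B) D).card * B.card ≤
      2 * ∑ p ∈ pairsIn (popularPart A B) D,
        (B.filter fun b => p.1 + b ∈ P ∧ p.2 + b ∈ P).card := by
    rw [Finset.mul_sum, ← smul_eq_mul]
    refine Finset.card_nsmul_le_sum _ _ _ fun p hp => ?_
    simp only [pairsIn, popularPart, Finset.mem_filter, Finset.mem_product] at hp
    obtain ⟨⟨⟨-, h2⟩, ⟨-, h3⟩⟩, -⟩ := hp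
    rw [← hP] at h2 h3
    have h4 := Finset.card_union_add_card_inter (B.filter fun b => p.1 + b ∈ P)
      (B.filter fun b => p.2 + b ∈ P)
    rw [← Finset.filter_and, ← Finset.filter_or] at h4
    have h5 := Finset.card_filter_le B (fun b => p.1 + b ∈ P ∨ p.2 + b ∈ P)
    omega
  refine h1.trans (Nat.mul_le_mul_left _ ?_)
  simp only [commonShifts, Finset.card_filter]
  rw [Finset.sum_comm, Finset.sum_comm (s := pairsIn P D)]
  refine Finset.sum_le_sum fun b _ => ?_
  rw [← Finset.card_filter, ← Finset.card_filter]
  refine Finset.card_le_card_of_injOn (fun p => (p.1 + b, p.2 + b)) ?_ ?_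
  · intro p hp
    simp only [pairsIn, Finset.coe_filter, Set.mem_ofPred_eq, Finset.mem_filter,
      Finset.mem_product, add_sub_add_right_eq_sub, add_sub_cancel_right] at hp ⊢
    have s1 := popularPart_subset A B hp.1.1.1
    have s2 := popularPart_subset A B hp.1.1.2
    tauto
  · rintro ⟨a, c⟩ _ ⟨d, e⟩ _ he
    simpa using he

/-- Each popular s has at least |A||B|/(16|A+B|) representations a + b. If s - s' = δ, then a - δ =
s' - b. -/
theorem card_pairsIn_popularSums_le (A B D : Finset ℝ) :
    A.card * B.card * (pairsIn (popularSums A B) D).card ≤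
      16 * ((A + B).card * ∑ y ∈ A + -D, rep A (-D) y * rep (A + B) (-B) y) := by
  classical
  set P := popularSums A B with hP
  set S := A + B
  have h1 : A.card * B.card * (pairsIn P D).card ≤
      16 * (S.card * ∑ q ∈ pairsIn P D, rep A B q.1) := by
    rw [Finset.mul_sum, Finset.mul_sum, mul_comm, ← smul_eq_mul]
    refine Finset.card_nsmul_le_sum _ _ _ fun q hq => ?_
    simp only [pairsIn, hP, popularSums, Finset.mem_filter, Finset.mem_product] at hq
    exact hq.1.1.2
  refine h1.trans (Nat.mul_le_mul_left _ (Nat.mul_le_mul_left _ ?_))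
  have h2 : ∑ p ∈ A ×ˢ (-D), rep S (-B) (p.1 + p.2) =
      ∑ y ∈ A + -D, rep A (-D) y * rep S (-B) y := by
    have := sum_add_eq_sum_rep (le_refl (A + -D)) (fun y => (rep S (-B) y : ℝ))
    exact_mod_cast this
  rw [← h2, Finset.sum_product]
  simp only [rep_eq_card, Finset.card_filter]
  rw [Finset.sum_comm]
  refine Finset.sum_le_sum fun a _ => ?_
  rw [← Finset.sum_product' (f := fun x s => if a + x - s ∈ -B then 1 else 0),
    ← Finset.card_filter, ← Finset.card_filter]
  refine Finset.card_le_card_of_injOn (fun q => (-(q.1 - q.2), q.2)) ?_ ?_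
  · intro q hq
    simp only [pairsIn, hP, popularSums, Finset.coe_filter, Set.mem_ofPred_eq,
      Finset.mem_filter, Finset.mem_product, Finset.mem_neg', neg_neg] at hq ⊢
    have e : -(a + -(q.1 - q.2) - q.2) = q.1 - a := by ring
    rw [e]
    exact ⟨⟨hq.1.2, hq.1.1.2.1⟩, hq.2⟩
  · rintro ⟨a, c⟩ _ ⟨d, e⟩ _ he
    simp only [Prod.mk.injEq] at he ⊢
    exact ⟨by linarith [he.1, he.2], he.2⟩

theorem sum_rep_sq_mul_rep_le {A B : Finset ℝ} {l m h : ℝ} (hl : 0 ≤ l) (hm : 0 ≤ m)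
    (hA : SumBound A l) (hB : SumBound B m)
    (hh₁ : 1 + Real.log ((A.card : ℝ) * A.card) ≤ h)
    (hh₂ : 1 + Real.log ((B.card : ℝ) * B.card) ≤ h) :
    (∑ t ∈ B + -B, (rep B (-B) t : ℝ) * (rep A (-A) t : ℝ) ^ 2) ^ 3 ≤
      (m ^ 3 * (B.card : ℝ) ^ 2 * h) * (l ^ 3 * (A.card : ℝ) ^ 2 * h) ^ 2 := by
  have h1 := holder_cube (B + -B) (fun y => (rep B (-B) y : ℝ)) (fun y => (rep A (-A) y : ℝ))
    (fun _ _ => by positivity) (fun _ _ => by positivity)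
  have h4 : ∑ y ∈ B + -B, (rep A (-A) y : ℝ) ^ 3 ≤ l ^ 3 * (A.card : ℝ) ^ 2 * h := by
    have := sum_rep_cube_le hl hA (-A) (B + -B)
    rw [Finset.card_neg] at this
    refine this.trans ?_
    gcongr
  have h5 : ∑ y ∈ B + -B, (rep B (-B) y : ℝ) ^ 3 ≤ m ^ 3 * (B.card : ℝ) ^ 2 * h := by
    have := sum_rep_cube_le hm hB (-B) (B + -B)
    rw [Finset.card_neg] at this
    refine this.trans ?_
    gcongr
  have n4 : 0 ≤ ∑ y ∈ B + -B, (rep A (-A) y : ℝ) ^ 3 := by positivity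
  have n5 : 0 ≤ ∑ y ∈ B + -B, (rep B (-B) y : ℝ) ^ 3 := by positivity
  have n6 := n5.trans h5
  refine h1.trans ?_
  gcongr

/-- The sixth power of the Cauchy–Schwarz bound, times (ab)^6, lets the bounds for q, W and E be
inserted; then a^6 b^4 cancels. -/
theorem combine_moment_bounds {N a b d S q W E l m h : ℝ} (ha : 0 < a) (hb : 0 < b) (hq : 0 ≤ q)
    (hE : 0 ≤ E)
    (g1 : (N * b) ^ 2 ≤ 4 * (q * E)) (f3 : a * b * q ≤ 16 * (S * W))
    (f4 : W ^ 6 ≤ (a * d) ^ 3 * (l ^ 3 * d ^ 2 * h) * (m ^ 3 * S ^ 2 * h) ^ 2)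
    (f5 : E ^ 3 ≤ (m ^ 3 * b ^ 2 * h) * (l ^ 3 * a ^ 2 * h) ^ 2) :
    N ^ 12 * b ^ 14 ≤
      2 ^ 36 * h ^ 9 * (l ^ 3) ^ 5 * (m ^ 3) ^ 4 * a ^ 5 * S ^ 10 * d ^ 5 := by
  have s1 : ((N * b) ^ 2) ^ 6 ≤ (4 * (q * E)) ^ 6 := pow_le_pow_left₀ (by positivity) g1 6
  have s2 : (a * b * q) ^ 6 ≤ (16 * (S * W)) ^ 6 := pow_le_pow_left₀ (by positivity) f3 6
  have s3 := pow_le_pow_left₀ (by positivity) f5 2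
  have hab : 0 < a ^ 6 * b ^ 4 := by positivity
  refine le_of_mul_le_mul_right ?_ hab
  generalize hF : (m ^ 3 * b ^ 2 * h) * (l ^ 3 * a ^ 2 * h) ^ 2 = F at s3
  generalize hG : (a * d) ^ 3 * (l ^ 3 * d ^ 2 * h) * (m ^ 3 * S ^ 2 * h) ^ 2 = G at f4
  calc N ^ 12 * b ^ 14 * (a ^ 6 * b ^ 4) = ((N * b) ^ 2) ^ 6 * (a * b) ^ 6 := by ring
    _ ≤ (4 * (q * E)) ^ 6 * (a * b) ^ 6 := mul_le_mul_of_nonneg_right s1 (by positivity)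
    _ = 4 ^ 6 * ((a * b * q) ^ 6 * (E ^ 3) ^ 2) := by ring
    _ ≤ 4 ^ 6 * ((16 * (S * W)) ^ 6 * F ^ 2) := by
        refine mul_le_mul_of_nonneg_left ?_ (by positivity)
        exact mul_le_mul s2 s3 (by positivity) (by positivity)
    _ = 2 ^ 36 * S ^ 6 * F ^ 2 * W ^ 6 := by ring
    _ ≤ 2 ^ 36 * S ^ 6 * F ^ 2 * G := mul_le_mul_of_nonneg_left f4 (by positivity)
    _ = _ := by rw [← hF, ← hG]; ring

/-- The number of pairs of popular elements with difference in a given set `D`. -/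
theorem card_pairsIn_pow_le {A B D : Finset ℝ} {l m h : ℝ} (hA0 : A.Nonempty)
    (hB0 : B.Nonempty) (hl : 0 ≤ l) (hm : 0 ≤ m) (hA : SumBound A l) (hB : SumBound B m)
    (hD : D ⊆ A + -A) (hh : 1 + 3 * Real.log ((A.card : ℝ) * B.card) ≤ h) :
    ((pairsIn (popularPart A B) D).card : ℝ) ^ 12 * (B.card : ℝ) ^ 14 ≤
      2 ^ 36 * h ^ 9 * (l ^ 3) ^ 5 * (m ^ 3) ^ 4 * (A.card : ℝ) ^ 5 *
        ((A + B).card : ℝ) ^ 10 * (D.card : ℝ) ^ 5 := by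
  set a : ℝ := (A.card : ℝ) with ha
  set b : ℝ := (B.card : ℝ) with hb
  set d : ℝ := (D.card : ℝ) with hd
  set S : ℝ := ((A + B).card : ℝ) with hS
  have ha1 : 1 ≤ a := by rw [ha]; exact_mod_cast Finset.card_pos.2 hA0
  have hb1 : 1 ≤ b := by rw [hb]; exact_mod_cast Finset.card_pos.2 hB0
  have hS1 : 1 ≤ S := by rw [hS]; exact_mod_cast Finset.card_pos.2 (hA0.add hB0)
  have hSab : S ≤ a * b := by rw [hS, ha, hb]; exact_mod_cast Finset.card_add_le
  have hda : d ≤ a * a := by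
    have h1 := (Finset.card_le_card hD).trans Finset.card_add_le
    rw [Finset.card_neg] at h1
    rw [hd, ha]; exact_mod_cast h1
  have hla : 0 ≤ Real.log a := Real.log_nonneg ha1
  have hlb : 0 ≤ Real.log b := Real.log_nonneg hb1
  have hlab : Real.log (a * b) = Real.log a + Real.log b :=
    Real.log_mul (by positivity) (by positivity)
  have haa : Real.log (a * a) = Real.log a + Real.log a :=
    Real.log_mul (by positivity) (by positivity)
  have hbb : Real.log (b * b) = Real.log b + Real.log b :=
    Real.log_mul (by positivity) (by positivity)
  -- The factor 3 in the hypothesis on h covers all logarithms, since |A+B| ≤ |A||B| and |D| ≤ |A|².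
  have hbS : Real.log (b * S) ≤ Real.log b + (Real.log a + Real.log b) := by
    rw [Real.log_mul (by positivity) (by positivity), ← hlab]
    gcongr
  have hh0 : 0 ≤ h := by linarith
  rcases Nat.eq_zero_or_pos D.card with hD0 | hD0
  · rw [card_pairsIn, Finset.card_eq_zero.1 hD0]
    simp only [Finset.sum_empty]
    have : (0 : ℝ) ≤ 2 ^ 36 * h ^ 9 * (l ^ 3) ^ 5 * (m ^ 3) ^ 4 * a ^ 5 * S ^ 10 * d ^ 5 := by
      positivity
    simpa using this
  have hd1 : 1 ≤ d := by rw [hd]; exact_mod_cast hD0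
  have had : Real.log (a * d) ≤ Real.log a + (Real.log a + Real.log a) := by
    rw [Real.log_mul (by positivity) (by positivity), ← haa]
    gcongr
  set N : ℝ := ((pairsIn (popularPart A B) D).card : ℝ) with hN
  set q : ℝ := ((pairsIn (popularSums A B) D).card : ℝ) with hq
  set W : ℝ := ∑ y ∈ A + -D, (rep A (-D) y : ℝ) * rep (A + B) (-B) y with hW
  set E : ℝ := ∑ t ∈ B + -B, (rep B (-B) t : ℝ) * (rep A (-A) t : ℝ) ^ 2 with hE
  set K : ℝ := ∑ p ∈ pairsIn (popularSums A B) D, (commonShifts A B p : ℝ) with hK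
  have f1 : N * b ≤ 2 * K := by
    rw [hN, hb, hK]; exact_mod_cast card_pairsIn_le_sum_commonShifts A B D
  have f2 : K ^ 2 ≤ q * E := by
    refine (sq_sum_le_card_mul_sum_sq (s := pairsIn (popularSums A B) D)
      (f := fun p => (commonShifts A B p : ℝ))).trans ?_
    refine mul_le_mul_of_nonneg_left ?_ (by positivity)
    refine le_trans (Finset.sum_le_sum_of_subset_of_nonneg ?_ (fun _ _ _ => by positivity))
      (sum_commonShifts_sq_le A B (A + B))
    refine (Finset.filter_subset _ _).trans (Finset.product_subset_product ?_ ?_) <;>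
      exact Finset.filter_subset _ _
  have f3 : a * b * q ≤ 16 * (S * W) := by
    rw [ha, hb, hq, hS, hW]; exact_mod_cast card_pairsIn_popularSums_le A B D
  have f4 := sum_rep_mul_rep_pow_le (S := A + B) (D := D) hl hm hA hB (h := h)
    (by linarith) (by linarith)
  have f5 := sum_rep_sq_mul_rep_le hl hm hA hB (h := h) (by linarith) (by linarith)
  rw [← hW, ← ha, ← hd, ← hS] at f4
  rw [← hE, ← ha, ← hb] at f5
  have hq0 : 0 ≤ q := Nat.cast_nonneg _
  have hE0 : 0 ≤ E :=
    Finset.sum_nonneg fun t _ => mul_nonneg (Nat.cast_nonneg _) (sq_nonneg _)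
  have g1 : (N * b) ^ 2 ≤ 4 * (q * E) := by
    have hNb : 0 ≤ N * b := mul_nonneg (Nat.cast_nonneg _) (Nat.cast_nonneg _)
    calc (N * b) ^ 2 ≤ (2 * K) ^ 2 := pow_le_pow_left₀ hNb f1 2
      _ = 4 * K ^ 2 := by ring
      _ ≤ _ := by linarith
  exact combine_moment_bounds (zero_lt_one.trans_le ha1) (zero_lt_one.trans_le hb1) hq0 hE0
    g1 f3 f4 f5

theorem half_card_mul_le_popularPart {A B : Finset ℝ} (hA : A.Nonempty) (hB : B.Nonempty) :
    (A.card : ℝ) * B.card ≤ 2 * ((popularPart A B).card * (popularPart B A).card) := by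
  have h1 := card_le_popularPart A B hB
  have h2 := card_le_popularPart B A hA
  have h3 := Nat.mul_le_mul h1 h2
  have h4 : A.card * B.card ≤ 2 * ((popularPart A B).card * (popularPart B A).card) := by
    nlinarith
  exact_mod_cast h4

/-! ### Bounds involving difference sets. -/

theorem differenceSet_bound {A B : Finset ℝ} {l m h : ℝ} (hA0 : A.Nonempty)
    (hB0 : B.Nonempty) (hl : 0 ≤ l) (hm : 0 ≤ m) (hA : SumBound A l) (hB : SumBound B m)
    (hh : 1 + 3 * Real.log ((A.card : ℝ) * B.card) ≤ h) :
    (A.card : ℝ) ^ 19 * (B.card : ℝ) ^ 14 ≤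
      2 ^ 48 * h ^ 9 * (l ^ 3) ^ 5 * (m ^ 3) ^ 4 *
        ((A + B).card : ℝ) ^ 10 * ((A + -A).card : ℝ) ^ 5 := by
  have h1 := card_pairsIn_pow_le hA0 hB0 hl hm hA hB (le_refl (A + -A)) hh
  have h2 : pairsIn (popularPart A B) (A + -A) = popularPart A B ×ˢ popularPart A B := by
    refine Finset.filter_true_of_mem fun p hp => ?_
    rw [Finset.mem_product] at hp
    rw [sub_eq_add_neg]
    exact Finset.add_mem_add (popularPart_subset A B hp.1)
      (Finset.neg_mem_neg (popularPart_subset A B hp.2))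
  have h3 := card_le_popularPart A B hB0
  have h4 : A.card ^ 2 ≤ 2 * (popularPart A B ×ˢ popularPart A B).card := by
    rw [Finset.card_product]
    nlinarith [Nat.mul_le_mul h3 h3]
  rw [h2] at h1
  generalize (popularPart A B ×ˢ popularPart A B).card = n at h1 h4
  have h4' : (A.card : ℝ) ^ 2 ≤ 2 * n := by exact_mod_cast h4
  have ha : (0 : ℝ) < (A.card : ℝ) := by exact_mod_cast Finset.card_pos.2 hA0
  generalize ((A + B).card : ℝ) = S at *
  generalize ((A + -A).card : ℝ) = D at *
  generalize (A.card : ℝ) = a at *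
  have hb : (0 : ℝ) ≤ (B.card : ℝ) := by positivity
  generalize (B.card : ℝ) = b at *
  have h5 := pow_le_pow_left₀ (by positivity) h4' 12
  refine le_of_mul_le_mul_right ?_ (pow_pos ha 5)
  calc a ^ 19 * b ^ 14 * a ^ 5 = (a ^ 2) ^ 12 * b ^ 14 := by ring
    _ ≤ (2 * (n : ℝ)) ^ 12 * b ^ 14 := mul_le_mul_of_nonneg_right h5 (by positivity)
    _ = 2 ^ 12 * ((n : ℝ) ^ 12 * b ^ 14) := by ring
    _ ≤ 2 ^ 12 * (2 ^ 36 * h ^ 9 * (l ^ 3) ^ 5 * (m ^ 3) ^ 4 * a ^ 5 * S ^ 10 * D ^ 5) :=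
        mul_le_mul_of_nonneg_left h1 (by positivity)
    _ = _ := by ring

/-- Multiplying `differenceSet_bound` by its version with A and B exchanged symmetrises it.
Replacing B by -B, which preserves `SumBound`, covers A - B. -/
theorem sumset_difference_bound {A B S : Finset ℝ} {l m h : ℝ} (hA0 : A.Nonempty)
    (hB0 : B.Nonempty) (hl : 0 ≤ l) (hm : 0 ≤ m) (hA : SumBound A l) (hB : SumBound B m)
    (hh : 1 + 3 * Real.log ((A.card : ℝ) * B.card) ≤ h) (hS : S = A + B ∨ S = A - B) :
    ((A.card : ℝ) * B.card) ^ 33 ≤ 2 ^ 96 * h ^ 18 * (l ^ 3 * m ^ 3) ^ 9 *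
      ((S.card : ℝ) ^ 20 * ((A - A).card : ℝ) ^ 5 * ((B - B).card : ℝ) ^ 5) := by
  have key : ∀ B' : Finset ℝ, B'.Nonempty → SumBound B' m → B'.card = B.card →
      (B' + -B').card = (B - B).card → S = A + B' →
      ((A.card : ℝ) * B.card) ^ 33 ≤ 2 ^ 96 * h ^ 18 * (l ^ 3 * m ^ 3) ^ 9 *
        ((S.card : ℝ) ^ 20 * ((A - A).card : ℝ) ^ 5 * ((B - B).card : ℝ) ^ 5) := by
    intro B' hB0' hB' hc hd hS
    have h1 := differenceSet_bound hA0 hB0' hl hm hA hB' (h := h) (by rw [hc]; exact hh)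
    have h2 := differenceSet_bound hB0' hA0 hm hl hB' hA (h := h)
      (by rw [hc, mul_comm (B.card : ℝ)]; exact hh)
    rw [add_comm B' A, hd, hc, ← hS] at h2
    rw [hc, ← hS, ← sub_eq_add_neg] at h1
    generalize ((A - A).card : ℝ) = D₁ at *
    generalize ((B - B).card : ℝ) = D₂ at *
    have ha : (0 : ℝ) ≤ (A.card : ℝ) := by positivity
    have hb : (0 : ℝ) ≤ (B.card : ℝ) := by positivity
    generalize (A.card : ℝ) = a at *
    generalize (B.card : ℝ) = b at *
    generalize (S.card : ℝ) = s at *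
    have h3 := mul_le_mul h1 h2 (by positivity) (le_trans (by positivity) h1)
    calc (a * b) ^ 33 = a ^ 19 * b ^ 14 * (b ^ 19 * a ^ 14) := by ring
      _ ≤ _ := h3
      _ = _ := by ring
  rcases hS with hS | hS
  · exact key B hB0 hB rfl (by rw [sub_eq_add_neg]) hS
  · refine key (-B) hB0.neg (sumBound_neg hB) (Finset.card_neg B) ?_ (by rw [hS, sub_eq_add_neg])
    rw [neg_neg, sub_eq_add_neg, add_comm]

/-! ### Additive energy and the bound by the sumset alone. -/

/-- The additive energy of `G`. -/
noncomputable def addEnergy (G : Finset ℝ) : ℝ := ∑ x ∈ G + -G, (rep G (-G) x : ℝ) ^ 2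

theorem addEnergy_nonneg (G : Finset ℝ) : 0 ≤ addEnergy G :=
  Finset.sum_nonneg fun _ _ => sq_nonneg _

theorem addEnergy_pos {G : Finset ℝ} (hG : G.Nonempty) : 0 < addEnergy G := by
  have h1 : ∑ x ∈ G + -G, (rep G (-G) x : ℝ) ≤ addEnergy G := by
    refine Finset.sum_le_sum fun x _ => ?_
    have : rep G (-G) x ≤ rep G (-G) x ^ 2 := Nat.le_self_pow (by norm_num) _
    exact_mod_cast this
  rw [sum_rep le_rfl, Finset.card_neg] at h1
  have : (0 : ℝ) < G.card := by exact_mod_cast Finset.card_pos.2 hG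
  exact lt_of_lt_of_le (by positivity) h1

/-- Cauchy–Schwarz twice: first on the sums, then after rewriting g + h = g' + h' as g - g' = h' -
h. -/
theorem card_mul_card_pow_le_addEnergy (G H : Finset ℝ) :
    ((G.card : ℝ) * H.card) ^ 4 ≤ ((G + H).card : ℝ) ^ 2 * (addEnergy G * addEnergy H) := by
  have h1 : ((G.card : ℝ) * H.card) ^ 2 ≤
      ((G + H).card : ℝ) * ∑ s ∈ G + H, (rep G H s : ℝ) ^ 2 := by
    rw [← sum_rep (le_refl (G + H))]
    exact sq_sum_le_card_mul_sum_sq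
  have h2 : ∑ s ∈ G + H, (rep G H s : ℝ) ^ 2 =
      ∑ t ∈ G + -G, (rep G (-G) t : ℝ) * rep (-H) H t := by
    have e1 := sum_add_eq_sum_rep (le_refl (G + H)) (fun s => (rep G H s : ℝ))
    have e2 := sum_add_eq_sum_rep (le_refl (G + -G)) (fun s => (rep (-H) H s : ℝ))
    simp only [sq]
    rw [← e1, ← e2, Finset.sum_product, Finset.sum_product]
    refine Finset.sum_congr rfl fun a _ => ?_
    have e3 : ∑ b ∈ H, rep G H (a + b) = ∑ x ∈ -G, rep (-H) H (a + x) := by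
      simp only [rep_eq_card, Finset.card_filter]
      rw [Finset.sum_comm]
      refine Finset.sum_nbij' (fun c => -c) (fun c => -c) ?_ ?_ ?_ ?_ ?_
      · intro c hc; exact Finset.neg_mem_neg hc
      · intro c hc; exact Finset.mem_neg'.1 hc
      · simp
      · simp
      · intro c _
        refine Finset.sum_nbij' (fun c => -c) (fun c => -c) ?_ ?_ ?_ ?_ ?_
        · intro c hc; exact Finset.neg_mem_neg hc
        · intro c hc; exact Finset.mem_neg'.1 hc
        · simp
        · simp
        · intro b _
          have : a + b - c = a + -c - -b := by ring
          rw [this]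
    exact_mod_cast e3
  have h3 : (∑ t ∈ G + -G, (rep G (-G) t : ℝ) * rep (-H) H t) ^ 2 ≤
      addEnergy G * addEnergy H := by
    refine (Finset.sum_mul_sq_le_sq_mul_sq _ _ _).trans ?_
    refine mul_le_mul_of_nonneg_left ?_ (addEnergy_nonneg G)
    rw [addEnergy, ← Finset.sum_filter_add_sum_filter_not (G + -G) (fun y => y ∈ H + -H)]
    have e : ∑ y ∈ (G + -G).filter (fun y => y ∉ H + -H), (rep (-H) H y : ℝ) ^ 2 = 0 :=
      Finset.sum_eq_zero fun y hy => by
        rw [rep_comm, rep_eq_zero (Finset.mem_filter.1 hy).2]; norm_num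
    rw [e, add_zero]
    simp only [rep_comm (-H)]
    exact Finset.sum_le_sum_of_subset_of_nonneg
      (fun y hy => (Finset.mem_filter.1 hy).2) (fun _ _ _ => by positivity)
  rw [← h2] at h3
  have h0 : 0 ≤ (G.card : ℝ) * H.card := by positivity
  calc ((G.card : ℝ) * H.card) ^ 4 = (((G.card : ℝ) * H.card) ^ 2) ^ 2 := by ring
    _ ≤ (((G + H).card : ℝ) * ∑ s ∈ G + H, (rep G H s : ℝ) ^ 2) ^ 2 :=
        pow_le_pow_left₀ (by positivity) h1 2
    _ = ((G + H).card : ℝ) ^ 2 * (∑ s ∈ G + H, (rep G H s : ℝ) ^ 2) ^ 2 := by ring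
    _ ≤ _ := mul_le_mul_of_nonneg_left h3 (by positivity)

/-- The exponents come from (t²d)^9 d^5 = (td)^12 (t³d)^2: the pair count handles the first factor,
the third moment the second. -/
theorem combine_energy_bounds {E h t d N a b S M M' : ℝ} (hE : 0 ≤ E) (ht : 0 < t) (hd : 0 < d)
    (hh : 0 ≤ h)
    (h1 : E ≤ 2 * h * (t ^ 2 * d)) (h2 : t * d ≤ N) (h3 : t ^ 3 * d ≤ M * a ^ 2 * h)
    (h4 : N ^ 12 * b ^ 14 ≤
      2 ^ 36 * h ^ 9 * M ^ 5 * M' ^ 4 * a ^ 5 * S ^ 10 * d ^ 5) :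
    E ^ 9 * b ^ 14 ≤ 2 ^ 45 * h ^ 20 * M ^ 7 * M' ^ 4 * a ^ 9 * S ^ 10 := by
  have s1 := pow_le_pow_left₀ hE h1 9
  have s2 : (t * d) ^ 12 * b ^ 14 ≤ N ^ 12 * b ^ 14 :=
    mul_le_mul_of_nonneg_right (pow_le_pow_left₀ (by positivity) h2 12) (by positivity)
  have s3 := pow_le_pow_left₀ (by positivity) h3 2
  have s4 := s2.trans h4
  refine le_of_mul_le_mul_right ?_ (pow_pos hd 5)
  calc E ^ 9 * b ^ 14 * d ^ 5 ≤ (2 * h * (t ^ 2 * d)) ^ 9 * b ^ 14 * d ^ 5 := by gcongr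
    _ = 2 ^ 9 * h ^ 9 * (((t * d) ^ 12 * b ^ 14) * (t ^ 3 * d) ^ 2) := by ring
    _ ≤ 2 ^ 9 * h ^ 9 * ((2 ^ 36 * h ^ 9 * M ^ 5 * M' ^ 4 * a ^ 5 * S ^ 10 * d ^ 5) *
          (M * a ^ 2 * h) ^ 2) := by
        refine mul_le_mul_of_nonneg_left ?_ (by positivity)
        exact mul_le_mul s4 s3 (by positivity) (le_trans (by positivity) s4)
    _ = _ := by ring

theorem addEnergy_popularPart_le {A B : Finset ℝ} {l m h : ℝ} (hA0 : A.Nonempty)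
    (hB0 : B.Nonempty) (hl : 0 ≤ l) (hm : 0 ≤ m) (hA : SumBound A l) (hB : SumBound B m)
    (hh : 1 + 3 * Real.log ((A.card : ℝ) * B.card) ≤ h) :
    addEnergy (popularPart A B) ^ 9 * (B.card : ℝ) ^ 14 ≤
      2 ^ 45 * h ^ 20 * (l ^ 3) ^ 7 * (m ^ 3) ^ 4 * (A.card : ℝ) ^ 9 *
        ((A + B).card : ℝ) ^ 10 := by
  have hGA : popularPart A B ⊆ A := popularPart_subset A B
  have hG0 : (popularPart A B).Nonempty := by
    have h1 := card_le_popularPart A B hB0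
    have h2 := Finset.card_pos.2 hA0
    exact Finset.card_pos.1 (by omega)
  have hpairs := fun D hD => card_pairsIn_pow_le (D := D) hA0 hB0 hl hm hA hB hD hh
  generalize popularPart A B = G at *
  have ha1 : (1 : ℝ) ≤ A.card := by exact_mod_cast Finset.card_pos.2 hA0
  have hb1 : (1 : ℝ) ≤ B.card := by exact_mod_cast Finset.card_pos.2 hB0
  have hla : 0 ≤ Real.log A.card := Real.log_nonneg ha1
  have hlb : 0 ≤ Real.log B.card := Real.log_nonneg hb1
  have hlab : Real.log ((A.card : ℝ) * B.card) = Real.log A.card + Real.log B.card :=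
    Real.log_mul (by positivity) (by positivity)
  have haa : Real.log ((A.card : ℝ) * A.card) = Real.log A.card + Real.log A.card :=
    Real.log_mul (by positivity) (by positivity)
  -- Up to a logarithm the energy sits on differences with at least t = √k representations; these
  -- form the set D for the pair count.
  obtain ⟨k, hk, hlev⟩ := exists_level (G + -G) (fun x => (rep G (-G) x : ℝ) ^ 2)
    (fun _ _ => sq_nonneg _) (addEnergy_pos hG0)
  set D := (G + -G).filter fun x => k ≤ (rep G (-G) x : ℝ) ^ 2 with hD
  have hDA : D ⊆ A + -A :=
    (Finset.filter_subset _ _).trans (Finset.add_subset_add hGA (Finset.neg_subset_neg hGA))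
  have ht : 0 < Real.sqrt k := Real.sqrt_pos.2 hk
  have htk : Real.sqrt k ^ 2 = k := Real.sq_sqrt hk.le
  set t := Real.sqrt k
  have hlevel : ∀ x ∈ D, t ≤ rep G (-G) x := fun x hx =>
    Real.sqrt_le_iff.2 ⟨by positivity, (Finset.mem_filter.1 hx).2⟩
  have hcardle : ((G + -G).card : ℝ) ≤ A.card * A.card := by
    have h1 := Finset.card_add_le (s := G) (t := -G)
    rw [Finset.card_neg] at h1
    have h2 := Finset.card_le_card hGA
    exact_mod_cast h1.trans (Nat.mul_le_mul h2 h2)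
  have hGG : (0 : ℝ) < (G + -G).card := by
    exact_mod_cast Finset.card_pos.2 (hG0.add hG0.neg)
  have hlog : 1 + Real.log (G + -G).card ≤ h := by
    have : Real.log (G + -G).card ≤ Real.log ((A.card : ℝ) * A.card) :=
      Real.log_le_log hGG hcardle
    linarith
  have hh0 : 0 ≤ h := by linarith
  have hE : addEnergy G ≤ 2 * h * (t ^ 2 * D.card) := by
    rw [htk]
    refine hlev.trans ?_
    have : 0 ≤ k * (D.card : ℝ) := mul_nonneg hk.le (Nat.cast_nonneg _)
    exact mul_le_mul_of_nonneg_right (by linarith) this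
  have hd : (0 : ℝ) < D.card := by
    rcases Nat.eq_zero_or_pos D.card with h0 | h0
    · have := addEnergy_pos hG0
      rw [h0] at hE
      simp at hE
      linarith
    · exact_mod_cast h0
  have h2 : t * D.card ≤ (pairsIn G D).card := by
    rw [card_pairsIn, mul_comm, ← nsmul_eq_mul]
    push_cast
    exact Finset.card_nsmul_le_sum _ _ _ hlevel
  have h3 : t ^ 3 * D.card ≤ l ^ 3 * (A.card : ℝ) ^ 2 * h := by
    have e1 : t ^ 3 * D.card ≤ ∑ x ∈ D, (rep A (-A) x : ℝ) ^ 3 := by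
      rw [mul_comm, ← nsmul_eq_mul]
      refine Finset.card_nsmul_le_sum _ _ _ fun x hx => ?_
      refine pow_le_pow_left₀ ht.le ((hlevel x hx).trans ?_) 3
      exact_mod_cast rep_mono hGA (Finset.neg_subset_neg hGA) x
    have e2 := sum_rep_cube_le hl hA (-A) D
    rw [Finset.card_neg] at e2
    refine e1.trans (e2.trans ?_)
    exact mul_le_mul_of_nonneg_left (by linarith) (by positivity)
  exact combine_energy_bounds (addEnergy_nonneg G) ht hd hh0 hE h2 h3 (hpairs D hDA)

/-- The ninth power of (|A||B|)^4 ≪ |A+B|² E F, for the energies E, F of the popular parts, matches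
the powers E^9 and F^9 in the energy bounds. -/
theorem sumset_bound {A B : Finset ℝ} {l m h : ℝ} (hA0 : A.Nonempty)
    (hB0 : B.Nonempty) (hl : 0 ≤ l) (hm : 0 ≤ m) (hA : SumBound A l) (hB : SumBound B m)
    (hh : 1 + 3 * Real.log ((A.card : ℝ) * B.card) ≤ h) :
    ((A.card : ℝ) * B.card) ^ 41 ≤ 2 ^ 126 * h ^ 40 * (l ^ 3 * m ^ 3) ^ 11 *
      ((A + B).card : ℝ) ^ 38 := by
  have h1 := addEnergy_popularPart_le hA0 hB0 hl hm hA hB hh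
  have h2 := addEnergy_popularPart_le hB0 hA0 hm hl hB hA (h := h) (by rw [mul_comm (B.card : ℝ)]; exact hh)
  have h3 := card_mul_card_pow_le_addEnergy (popularPart A B) (popularPart B A)
  have h4 := half_card_mul_le_popularPart hA0 hB0
  have h5 : ((popularPart A B + popularPart B A).card : ℝ) ≤ (A + B).card := by
    exact_mod_cast Finset.card_le_card
      (Finset.add_subset_add (popularPart_subset A B) (popularPart_subset B A))
  have n1 := addEnergy_nonneg (popularPart A B)
  have n2 := addEnergy_nonneg (popularPart B A)
  rw [add_comm B A] at h2
  have ha : (0 : ℝ) < (A.card : ℝ) := by exact_mod_cast Finset.card_pos.2 hA0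
  have hb : (0 : ℝ) < (B.card : ℝ) := by exact_mod_cast Finset.card_pos.2 hB0
  have n3 : (0 : ℝ) ≤ (popularPart A B + popularPart B A).card := Nat.cast_nonneg _
  have n4 : (0 : ℝ) ≤ (A + B).card := Nat.cast_nonneg _
  generalize ((popularPart A B + popularPart B A).card : ℝ) = S' at *
  generalize ((popularPart A B).card : ℝ) * ((popularPart B A).card : ℝ) = p at *
  generalize addEnergy (popularPart A B) = E at *
  generalize addEnergy (popularPart B A) = F at *
  generalize (A.card : ℝ) = a at *
  generalize (B.card : ℝ) = b at *
  generalize ((A + B).card : ℝ) = S at *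
  have s1 : (a * b) ^ 4 ≤ 2 ^ 4 * (S ^ 2 * (E * F)) := by
    calc (a * b) ^ 4 ≤ (2 * p) ^ 4 := pow_le_pow_left₀ (by positivity) h4 4
      _ = 2 ^ 4 * p ^ 4 := by ring
      _ ≤ 2 ^ 4 * (S' ^ 2 * (E * F)) := by linarith
      _ ≤ 2 ^ 4 * (S ^ 2 * (E * F)) := by gcongr
  have s2 := pow_le_pow_left₀ (by positivity) s1 9
  have s3 := mul_le_mul h1 h2 (by positivity) (le_trans (by positivity) h1)
  refine le_of_mul_le_mul_right ?_ (pow_pos (mul_pos ha hb) 9)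
  calc (a * b) ^ 41 * (a * b) ^ 9 = ((a * b) ^ 4) ^ 9 * (a * b) ^ 14 := by ring
    _ ≤ (2 ^ 4 * (S ^ 2 * (E * F))) ^ 9 * (a * b) ^ 14 :=
        mul_le_mul_of_nonneg_right s2 (by positivity)
    _ = 2 ^ 36 * S ^ 18 * (E ^ 9 * b ^ 14 * (F ^ 9 * a ^ 14)) := by ring
    _ ≤ _ := mul_le_mul_of_nonneg_left s3 (by positivity)
    _ = _ := by ring

/-! ### Assembling the two halves. -/

/-- In the product of the two bounds the constants appear as (l m l' m')^{3q}, at most (ρh)^{6q}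
(ab)^{3q}; this lowers the exponent from 2p to e. It is used with 82 - 33 = 49 and 66 - 27 = 39. -/
theorem combine_halves {a b κ ρ c h x u y v l l' m m' R R' : ℝ} (p q k e : ℕ)
    (hpe : 2 * p = e + 3 * q) (ha : 0 < a) (hb : 0 < b) (hκ : 0 ≤ κ)
    (hh : 0 ≤ h) (hl : 0 ≤ l) (hl' : 0 ≤ l') (hm : 0 ≤ m) (hm' : 0 ≤ m')
    (hR : 0 ≤ R) (hR' : 0 ≤ R')
    (h1 : a * b ≤ κ * (x * u)) (h2 : a * b ≤ κ * (y * v))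
    (h3 : l * m ≤ ρ * h * a) (h4 : l' * m' ≤ ρ * h * b)
    (h5 : (x * u) ^ p ≤ c * h ^ k * (l ^ 3 * l' ^ 3) ^ q * R)
    (h6 : (y * v) ^ p ≤ c * h ^ k * (m ^ 3 * m' ^ 3) ^ q * R') :
    (a * b) ^ e ≤ κ ^ (2 * p) * c ^ 2 * ρ ^ (6 * q) * h ^ (2 * k + 6 * q) * (R * R') := by
  have hab : 0 < a * b := mul_pos ha hb
  have s1 : (a * b) ^ p ≤ κ ^ p * (c * h ^ k * (l ^ 3 * l' ^ 3) ^ q * R) := by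
    refine (pow_le_pow_left₀ hab.le h1 p).trans ?_
    rw [mul_pow]
    exact mul_le_mul_of_nonneg_left h5 (pow_nonneg hκ p)
  have s2 : (a * b) ^ p ≤ κ ^ p * (c * h ^ k * (m ^ 3 * m' ^ 3) ^ q * R') := by
    refine (pow_le_pow_left₀ hab.le h2 p).trans ?_
    rw [mul_pow]
    exact mul_le_mul_of_nonneg_left h6 (pow_nonneg hκ p)
  have s3 := mul_le_mul s1 s2 (by positivity) (le_trans (by positivity) s1)
  have s4 : ((l * m) * (l' * m')) ^ (3 * q) ≤ ((ρ * h * a) * (ρ * h * b)) ^ (3 * q) :=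
    pow_le_pow_left₀ (by positivity)
      (mul_le_mul h3 h4 (by positivity) (le_trans (by positivity) h3)) _
  refine le_of_mul_le_mul_right ?_ (pow_pos hab (3 * q))
  calc (a * b) ^ e * (a * b) ^ (3 * q) = (a * b) ^ p * (a * b) ^ p := by
        rw [← pow_add, ← pow_add, ← hpe, two_mul]
    _ ≤ _ := s3
    _ = κ ^ (2 * p) * c ^ 2 * h ^ (2 * k) * (R * R') * ((l * m) * (l' * m')) ^ (3 * q) := by ring
    _ ≤ κ ^ (2 * p) * c ^ 2 * h ^ (2 * k) * (R * R') *
          ((ρ * h * a) * (ρ * h * b)) ^ (3 * q) :=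
        mul_le_mul_of_nonneg_left s4 (by positivity)
    _ = _ := by ring

theorem cast_pow_nonneg (n k : ℕ) : (0 : ℝ) ≤ (n : ℝ) ^ k := pow_nonneg (Nat.cast_nonneg n) k

theorem cast_pow_mul_nonneg (p q r i j k : ℕ) :
    (0 : ℝ) ≤ (p : ℝ) ^ i * (q : ℝ) ^ j * (r : ℝ) ^ k :=
  mul_nonneg (mul_nonneg (cast_pow_nonneg _ _) (cast_pow_nonneg _ _)) (cast_pow_nonneg _ _)

theorem card_pow_mono {P P' Q Q' R R' : Finset ℝ} (hP : P ⊆ P') (hQ : Q ⊆ Q') (hR : R ⊆ R') :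
    (P.card : ℝ) ^ 20 * ((Q - Q).card : ℝ) ^ 5 * ((R - R).card : ℝ) ^ 5 ≤
      (P'.card : ℝ) ^ 20 * ((Q' - Q').card : ℝ) ^ 5 * ((R' - R').card : ℝ) ^ 5 := by
  have e1 := Finset.card_le_card hP
  have e2 := Finset.card_le_card (Finset.sub_subset_sub hQ hQ)
  have e3 := Finset.card_le_card (Finset.sub_subset_sub hR hR)
  exact_mod_cast Nat.mul_le_mul (Nat.mul_le_mul (Nat.pow_le_pow_left e1 20)
    (Nat.pow_le_pow_left e2 5)) (Nat.pow_le_pow_left e3 5)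

theorem sumset_growth_of_curved {A B : Finset ℝ} {f g : ℝ → ℝ} {h : ℝ}
    (hA0 : A.Nonempty) (hB0 : B.Nonempty) (hf : Set.InjOn f A) (hg : Set.InjOn g B)
    (hfc : Curved f A) (hgc : Curved g B)
    (hh : 1 + 3 * Real.log ((A.card : ℝ) * B.card) ≤ h) :
    ((A.card : ℝ) * B.card) ^ 49 ≤ 4 ^ 82 * (2 ^ 126) ^ 2 * 20 ^ 66 * h ^ 146 *
        (((A + B).card : ℝ) ^ 38 * ((A.image f + B.image g).card : ℝ) ^ 38) ∧
    ∀ S T : Finset ℝ, (S = A + B ∨ S = A - B) →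
      (T = A.image f + B.image g ∨ T = A.image f - B.image g) →
      ((A.card : ℝ) * B.card) ^ 39 ≤ 4 ^ 66 * (2 ^ 96) ^ 2 * 20 ^ 54 * h ^ 90 *
        (((S.card : ℝ) ^ 20 * ((A - A).card : ℝ) ^ 5 * ((B - B).card : ℝ) ^ 5) *
         ((T.card : ℝ) ^ 20 * ((A.image f - A.image f).card : ℝ) ^ 5 *
          ((B.image g - B.image g).card : ℝ) ^ 5)) := by
  obtain ⟨X, hXA, Y, hYA, l, m, hl, hm, hX, hY, hXl, hYm, hlm⟩ := hfc.exists_halves hA0 hf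
  obtain ⟨U, hUB, V, hVB, l', m', hl', hm', hU, hV, hUl, hVm, hlm'⟩ := hgc.exists_halves hB0 hg
  have pA := Finset.card_pos.2 hA0
  have pB := Finset.card_pos.2 hB0
  have hX0 : X.Nonempty := Finset.card_pos.1 (by omega)
  have hY0 : Y.Nonempty := Finset.card_pos.1 (by omega)
  have hU0 : U.Nonempty := Finset.card_pos.1 (by omega)
  have hV0 : V.Nonempty := Finset.card_pos.1 (by omega)
  have hfY : (Y.image f).card = Y.card :=
    Finset.card_image_of_injOn (hf.mono (by exact_mod_cast hYA))
  have hgV : (V.image g).card = V.card :=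
    Finset.card_image_of_injOn (hg.mono (by exact_mod_cast hVB))
  have ha : (1 : ℝ) ≤ A.card := by exact_mod_cast pA
  have hb : (1 : ℝ) ≤ B.card := by exact_mod_cast pB
  have hla : 0 ≤ Real.log A.card := Real.log_nonneg ha
  have hlb : 0 ≤ Real.log B.card := Real.log_nonneg hb
  have hlab : Real.log ((A.card : ℝ) * B.card) = Real.log A.card + Real.log B.card :=
    Real.log_mul (by positivity) (by positivity)
  have hh0 : 0 ≤ h := by linarith
  have hsub : ∀ m n : ℕ, 0 < m → 0 < n → m ≤ A.card → n ≤ B.card →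
      1 + 3 * Real.log ((m : ℝ) * n) ≤ h := by
    intro m n hm hn hmA hnB
    refine le_trans ?_ hh
    gcongr
  have hXU := hsub X.card U.card hX0.card_pos hU0.card_pos (Finset.card_le_card hXA)
    (Finset.card_le_card hUB)
  have hYV : 1 + 3 * Real.log (((Y.image f).card : ℝ) * (V.image g).card) ≤ h := by
    rw [hfY, hgV]
    exact hsub Y.card V.card hY0.card_pos hV0.card_pos (Finset.card_le_card hYA)
      (Finset.card_le_card hVB)
  have h1 : (A.card : ℝ) * B.card ≤ 4 * ((X.card : ℝ) * U.card) := by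
    have : A.card * B.card ≤ 4 * (X.card * U.card) := by nlinarith [Nat.mul_le_mul hX hU]
    exact_mod_cast this
  have h2 : (A.card : ℝ) * B.card ≤ 4 * (((Y.image f).card : ℝ) * (V.image g).card) := by
    rw [hfY, hgV]
    have : A.card * B.card ≤ 4 * (Y.card * V.card) := by nlinarith [Nat.mul_le_mul hY hV]
    exact_mod_cast this
  have h3 : l * m ≤ 20 * h * A.card := by
    refine hlm.trans ?_
    gcongr
    linarith
  have h4 : l' * m' ≤ 20 * h * B.card := by
    refine hlm'.trans ?_
    gcongr
    linarith
  have hfYA : Y.image f ⊆ A.image f := Finset.image_subset_image hYA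
  have hgVB : V.image g ⊆ B.image g := Finset.image_subset_image hVB
  have ha0 : (0 : ℝ) < A.card := by linarith
  have hb0 : (0 : ℝ) < B.card := by linarith
  have hcoef : ∀ (n k q : ℕ) (u v : ℝ), 0 ≤ u → 0 ≤ v →
      0 ≤ 2 ^ n * h ^ k * (u ^ 3 * v ^ 3) ^ q := fun n k q u v hu hv =>
    mul_nonneg (mul_nonneg (pow_nonneg zero_le_two n) (pow_nonneg hh0 k))
      (pow_nonneg (mul_nonneg (pow_nonneg hu 3) (pow_nonneg hv 3)) q)
  constructor
  · have h5 := sumset_bound hX0 hU0 hl hl' hXl hUl hXU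
    have h6 := sumset_bound (hY0.image f) (hV0.image g) hm hm' hYm hVm hYV
    have t1 : ((X + U).card : ℝ) ≤ (A + B).card := by
      exact_mod_cast Finset.card_le_card (Finset.add_subset_add hXA hUB)
    have t2 : ((Y.image f + V.image g).card : ℝ) ≤ (A.image f + B.image g).card := by
      exact_mod_cast Finset.card_le_card (Finset.add_subset_add hfYA hgVB)
    have h5' := h5.trans (mul_le_mul_of_nonneg_left
      (pow_le_pow_left₀ (Nat.cast_nonneg _) t1 38) (hcoef _ _ _ _ _ hl hl'))
    have h6' := h6.trans (mul_le_mul_of_nonneg_left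
      (pow_le_pow_left₀ (Nat.cast_nonneg _) t2 38) (hcoef _ _ _ _ _ hm hm'))
    exact combine_halves 41 11 40 49 (by norm_num) ha0 hb0 (by norm_num) hh0 hl hl' hm hm'
      (cast_pow_nonneg _ _) (cast_pow_nonneg _ _) h1 h2 h3 h4 h5' h6'
  · intro S T hS hT
    obtain ⟨S', hS'S, hS'⟩ : ∃ S' ⊆ S, S' = X + U ∨ S' = X - U := by
      rcases hS with rfl | rfl
      · exact ⟨_, Finset.add_subset_add hXA hUB, Or.inl rfl⟩
      · exact ⟨_, Finset.sub_subset_sub hXA hUB, Or.inr rfl⟩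
    obtain ⟨T', hT'T, hT'⟩ :
        ∃ T' ⊆ T, T' = Y.image f + V.image g ∨ T' = Y.image f - V.image g := by
      rcases hT with rfl | rfl
      · exact ⟨_, Finset.add_subset_add hfYA hgVB, Or.inl rfl⟩
      · exact ⟨_, Finset.sub_subset_sub hfYA hgVB, Or.inr rfl⟩
    have h5 := sumset_difference_bound hX0 hU0 hl hl' hXl hUl hXU hS'
    have h6 := sumset_difference_bound (hY0.image f) (hV0.image g) hm hm' hYm hVm hYV hT'
    have h5' := h5.trans (mul_le_mul_of_nonneg_left (card_pow_mono hS'S hXA hUB) (hcoef _ _ _ _ _ hl hl'))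
    have h6' := h6.trans (mul_le_mul_of_nonneg_left (card_pow_mono hT'T hfYA hgVB) (hcoef _ _ _ _ _ hm hm'))
    exact combine_halves 33 9 18 39 (by norm_num) ha0 hb0 (by norm_num) hh0 hl hl' hm hm'
      (cast_pow_mul_nonneg _ _ _ _ _ _) (cast_pow_mul_nonneg _ _ _ _ _ _) h1 h2 h3 h4 h5' h6'

/-- Passing to curved thirds of both sets costs 9 = 3 · 3 in the product, and h = 4L costs 4^k. -/
theorem mul_pow_le_of_thirds {a b a' b' C D h L R : ℝ} {e k K : ℕ} (ha : 0 ≤ a) (hb : 0 ≤ b)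
    (ha' : a ≤ 3 * a') (hb' : b ≤ 3 * b') (hC : 0 ≤ C) (hL : 1 ≤ L) (hh : h = 4 * L)
    (hR : 0 ≤ R) (hk : k ≤ K) (hD : 9 ^ e * C * 4 ^ k ≤ D)
    (h1 : (a' * b') ^ e ≤ C * h ^ k * R) : (a * b) ^ e ≤ D * L ^ K * R := by
  have h2 : a * b ≤ 9 * (a' * b') := by
    have := mul_le_mul ha' hb' hb (ha.trans ha')
    linarith
  calc (a * b) ^ e ≤ (9 * (a' * b')) ^ e := pow_le_pow_left₀ (mul_nonneg ha hb) h2 e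
    _ = 9 ^ e * (a' * b') ^ e := by rw [mul_pow]
    _ ≤ 9 ^ e * (C * h ^ k * R) := mul_le_mul_of_nonneg_left h1 (by positivity)
    _ = (9 ^ e * C * 4 ^ k) * L ^ k * R := by rw [hh, mul_pow]; ring
    _ ≤ D * L ^ K * R := by
      have := pow_le_pow_right₀ hL hk
      have h0 : 0 ≤ D := le_trans (by positivity) hD
      gcongr

theorem mainTheorem1 :
    ∃ (C : ℝ) (K : ℕ), 0 < C ∧
      ∀ (I J : Set ℝ) (f g : ℝ → ℝ),
        (StrictConvexOn ℝ I f ∨ StrictConcaveOn ℝ I f) →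
        (StrictConvexOn ℝ J g ∨ StrictConcaveOn ℝ J g) →
        ∀ A B : Finset ℝ, (A : Set ℝ) ⊆ I → (B : Set ℝ) ⊆ J →
          ((A.card : ℝ) * (B.card : ℝ)) ^ 49 ≤
              C * Real.log (2 + (A.card : ℝ) * (B.card : ℝ)) ^ K *
                (((A + B).card : ℝ) ^ 38 * ((A.image f + B.image g).card : ℝ) ^ 38) ∧
          ∀ S T : Finset ℝ,
            (S = A + B ∨ S = A - B) →
            (T = A.image f + B.image g ∨ T = A.image f - B.image g) →
            (A.card : ℝ) ^ 39 * (B.card : ℝ) ^ 39 ≤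
              C * Real.log (2 + (A.card : ℝ) * (B.card : ℝ)) ^ K *
                ((S.card : ℝ) ^ 20 * (T.card : ℝ) ^ 20 *
                  ((A - A).card : ℝ) ^ 5 * ((B - B).card : ℝ) ^ 5 *
                  ((A.image f - A.image f).card : ℝ) ^ 5 *
                  ((B.image g - B.image g).card : ℝ) ^ 5) := by
  obtain ⟨c₁, hc₁, hc₁'⟩ : ∃ c : ℝ, 0 ≤ c ∧ 4 ^ 82 * (2 ^ 126) ^ 2 * 20 ^ 66 = c :=
    ⟨_, by positivity, rfl⟩
  obtain ⟨c₂, hc₂, hc₂'⟩ : ∃ c : ℝ, 0 ≤ c ∧ 4 ^ 66 * (2 ^ 96) ^ 2 * 20 ^ 54 = c :=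
    ⟨_, by positivity, rfl⟩
  obtain ⟨d₁, hd₁⟩ : ∃ d : ℝ, 9 ^ 49 * c₁ * 4 ^ 146 = d := ⟨_, rfl⟩
  obtain ⟨d₂, hd₂⟩ : ∃ d : ℝ, 9 ^ 39 * c₂ * 4 ^ 90 = d := ⟨_, rfl⟩
  have hd₁0 : 0 ≤ d₁ := hd₁ ▸ by positivity
  have hd₂0 : 0 ≤ d₂ := hd₂ ▸ by positivity
  -- The logarithmic exponents are 2·40 + 6·11 = 146 and 2·18 + 6·9 = 90; the larger serves for
  -- both.
  refine ⟨d₁ + d₂ + 1, 146, by linarith, ?_⟩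
  intro I J f g hf hg A B hA hB
  have hL0 : 0 ≤ Real.log (2 + (A.card : ℝ) * (B.card : ℝ)) :=
    Real.log_nonneg (by
      have : (0 : ℝ) ≤ (A.card : ℝ) * B.card := by positivity
      linarith)
  by_cases h0 : A.card * B.card = 0
  · have h0' : (A.card : ℝ) * B.card = 0 := by exact_mod_cast h0
    have hC : 0 ≤ d₁ + d₂ + 1 := by linarith
    rw [h0'] at hL0 ⊢
    refine ⟨?_, fun S T _ _ => ?_⟩
    · rw [zero_pow (by norm_num)]
      exact mul_nonneg (mul_nonneg hC (pow_nonneg hL0 _)) (by positivity)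
    · rw [← mul_pow, h0', zero_pow (by norm_num)]
      exact mul_nonneg (mul_nonneg hC (pow_nonneg hL0 _)) (by positivity)
  have hpos : 0 < A.card * B.card := Nat.pos_of_ne_zero h0
  obtain ⟨A', hA'A, hA'c, hA'i, hA'C⟩ := exists_curved hf A hA
  obtain ⟨B', hB'B, hB'c, hB'i, hB'C⟩ := exists_curved hg B hB
  have pA : 0 < A.card := Nat.pos_of_mul_pos_right hpos
  have pB : 0 < B.card := Nat.pos_of_mul_pos_left hpos
  have pA' : 0 < A'.card := by omega
  have pB' : 0 < B'.card := by omega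
  have hab1 : (1 : ℝ) ≤ (A.card : ℝ) * B.card := by exact_mod_cast hpos
  set L := Real.log (2 + (A.card : ℝ) * (B.card : ℝ)) with hLdef
  -- For nonempty sets 2 + |A||B| ≥ 3 > e. Hence 1 + 3 log ≤ 4L below.
  have hL1 : 1 ≤ L := by
    rw [hLdef, Real.le_log_iff_exp_le (by linarith)]
    linarith [Real.exp_one_lt_d9]
  have hlog : 1 + 3 * Real.log ((A'.card : ℝ) * B'.card) ≤ 4 * L := by
    have : Real.log ((A'.card : ℝ) * B'.card) ≤ L := by
      refine Real.log_le_log (by positivity) ?_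
      have : A'.card * B'.card ≤ A.card * B.card :=
        Nat.mul_le_mul (Finset.card_le_card hA'A) (Finset.card_le_card hB'B)
      have : (A'.card : ℝ) * B'.card ≤ A.card * B.card := by exact_mod_cast this
      linarith
    linarith
  obtain ⟨h1, h2⟩ := sumset_growth_of_curved (Finset.card_pos.1 pA') (Finset.card_pos.1 pB')
    hA'i hB'i hA'C hB'C hlog
  rw [hc₁'] at h1
  rw [hc₂'] at h2
  have ha3 : (A.card : ℝ) ≤ 3 * A'.card := by exact_mod_cast hA'c
  have hb3 : (B.card : ℝ) ≤ 3 * B'.card := by exact_mod_cast hB'c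
  have hfA : A'.image f ⊆ A.image f := Finset.image_subset_image hA'A
  have hgB : B'.image g ⊆ B.image g := Finset.image_subset_image hB'B
  have cast_le : ∀ {P Q : Finset ℝ}, P ⊆ Q → (P.card : ℝ) ≤ Q.card := fun h => by
    exact_mod_cast Finset.card_le_card h
  have s1 := cast_le (Finset.add_subset_add hA'A hB'B)
  have s2 := cast_le (Finset.add_subset_add hfA hgB)
  refine ⟨?_, fun S T hS hT => ?_⟩
  · refine mul_pow_le_of_thirds (Nat.cast_nonneg _) (Nat.cast_nonneg _) ha3 hb3 hc₁ hL1 rfl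
      (mul_nonneg (cast_pow_nonneg _ _) (cast_pow_nonneg _ _)) le_rfl (by linarith) (h1.trans ?_)
    refine mul_le_mul_of_nonneg_left ?_ (mul_nonneg hc₁ (pow_nonneg (by linarith) _))
    exact mul_le_mul (pow_le_pow_left₀ (Nat.cast_nonneg _) s1 _)
      (pow_le_pow_left₀ (Nat.cast_nonneg _) s2 _) (cast_pow_nonneg _ _) (cast_pow_nonneg _ _)
  · obtain ⟨S', hS'S, hS'⟩ : ∃ S' ⊆ S, S' = A' + B' ∨ S' = A' - B' := by
      rcases hS with rfl | rfl
      · exact ⟨_, Finset.add_subset_add hA'A hB'B, Or.inl rfl⟩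
      · exact ⟨_, Finset.sub_subset_sub hA'A hB'B, Or.inr rfl⟩
    obtain ⟨T', hT'T, hT'⟩ :
        ∃ T' ⊆ T, T' = A'.image f + B'.image g ∨ T' = A'.image f - B'.image g := by
      rcases hT with rfl | rfl
      · exact ⟨_, Finset.add_subset_add hfA hgB, Or.inl rfl⟩
      · exact ⟨_, Finset.sub_subset_sub hfA hgB, Or.inr rfl⟩
    rw [← mul_pow]
    refine mul_pow_le_of_thirds (Nat.cast_nonneg _) (Nat.cast_nonneg _) ha3 hb3 hc₂ hL1 rfl
      ?_ (by norm_num : 90 ≤ 146) (by linarith) ((h2 S' T' hS' hT').trans ?_)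
    · have := mul_nonneg (cast_pow_mul_nonneg S.card (A - A).card (B - B).card 20 5 5)
        (cast_pow_mul_nonneg T.card (A.image f - A.image f).card
          (B.image g - B.image g).card 20 5 5)
      linarith
    refine mul_le_mul_of_nonneg_left ?_ (mul_nonneg hc₂ (pow_nonneg (by linarith) _))
    calc _ ≤ ((S.card : ℝ) ^ 20 * ((A - A).card : ℝ) ^ 5 * ((B - B).card : ℝ) ^ 5) *
         ((T.card : ℝ) ^ 20 * ((A.image f - A.image f).card : ℝ) ^ 5 *
          ((B.image g - B.image g).card : ℝ) ^ 5) :=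
        mul_le_mul (card_pow_mono hS'S hA'A hB'B) (card_pow_mono hT'T hfA hgB)
          (cast_pow_mul_nonneg _ _ _ _ _ _) (cast_pow_mul_nonneg _ _ _ _ _ _)
      _ = _ := by ring
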